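/- Let $n\ge 1$ and let $X$ be a complete metric space. $\mathrm{Lip}(X,\mathbb R^n)$ denotes the real vector space of Lipschitz maps $X\to\mathbb R^n$ (Euclidean norm on $\mathbb R^n$), $\mathrm{Lip}_b(X)$ the space of bounded Lipschitz functions $X\to\mathbb R$, and $\mathcal H^n$ the $n$-dimensional Hausdorff measure. *Definitions.* A *Lipschitz norm* is a semi-norm $\mathbf L:\mathrm{Lip}(X,\mathbb R^n)\to\mathbb R$; it is *compatible* if $\mathbf L(\beta\circ\pi)\le \mathrm{Lip}(\beta)\,\mathbf L(\pi)$ for all $\beta\in\mathrm{Lip}(\mathbb R^n,\mathbb R^n)$ and $\pi\in \mathrm{Lip}(X,\mathbb R^n)$, where $\mathrm{Lip}(\beta)$ is the best Lipschitz constant of $\beta$. An ($n$-dimensional) *$\mathbf L$-current* is a functional $T(f,\pi)$, $f\in\mathrm{Lip}_b(X)$, $\pi=(\pi^{(1)},\dots,\pi^{(n)})\in\mathrm{Lip}(X,\mathbb R^n)$, multilinear in $(f,\pi^{(1)},\dots,\pi^{(n)})$, such that 1. if $\pi_i\to\pi$ pointwise and $\sup_i\mathbf L(\pi_i)<\infty$,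 then $T(f,\pi_i)\to T(f,\pi)$; 2. $T(f,\pi)=0$ if some $\pi^{(j)}$ is constant on an open neighbourhood of $\operatorname{spt} f$; 3. there is a finite Borel measure $\mu$ on $X$ with $|T(f,\pi)|\le \mathbf L(\pi)^n\int_X|f|\,d\mu$ for all $(f,\pi)$. The smallest measure $\mu$ as in 3 is the *mass measure* $\|T\|_{\mathbf L}$. An $\mathcal H^n$-measurable set $S\subset X$ is *$n$-rectifiable* if, up to an $\mathcal H^n$-null set, it is covered by countably many Lipschitz images of Borel subsets of $\mathbb R^n$. A *bi-Lipschitz parametrization* $(K_i,\varphi_i)_{i\in\mathbb N}$ of $S$ consists of compact sets $K_i\subset\mathbb R^n$ and bi-Lipschitz embeddings $\varphi_i:K_i\to X$ with pairwise disjoint images such that $S$ and $\bigcup_i\varphi_i(K_i)$ are equal up to an $\mathcal H^n$-null set. An $\mathbf L$-current $T$ is *rectifiable* if $\|T\|_{\mathbf L}$ vanishes on $\mathcal H^n$-negligible Borel sets and is concentrated on an $n$-rectifiable set. For $\theta\in L^1(\mathbb R^n)$, a compact set $K\subset\mathbb R^n$ and a Lipschitz map $\varphi:K\to X$ put $$\varphi_\#[[\theta]]\,(f,\pi)=\int_K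 \theta\cdot (f\circ\varphi)\cdot\det(D\tilde\pi)\,d\mathscr L^n,$$ where $\tilde\pi:\mathbb R^n\to\mathbb R^n$ is any Lipschitz extension of $\pi\circ\varphi$ (the value does not depend on the choice). **Proposition.** Let $\mathbf L$ be a compatible Lipschitz norm on $\mathrm{Lip}(X,\mathbb R^n)$, let $T$ be an $n$-dimensional rectifiable $\mathbf L$-current in $X$ whose mass measure is concentrated on the $n$-rectifiable set $S\subset X$, and let $(K_i,\varphi_i)_{i\in\mathbb N}$ be a bi-Lipschitz parametrization of $S$. Then there exist functions $\theta_i\in L^1(\mathbb R^n)$ with $\operatorname{spt}\theta_i\subset K_i$ such that every $\varphi_{i\#}[[\theta_i]]$ is an $\mathbf L$-current, $$T(f,\pi)=\sum_{i}\varphi_{i\#}[[\theta_i]]\,(f,\pi)\quad\text{for all } f\in \mathrm{Lip}_b(X),\ \pi\in\mathrm{Lip}(X,\mathbb R^n),$$ with absolute convergence, and $$\|T\|_{\mathbf L}=\sum_{i}\big\|\varphi_{i\#}[[\theta_i]]\big\|_{\mathbf L}.$$ -/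

import Mathlib

open MeasureTheory Filter Topology
open scoped NNReal

namespace LCurrent

/-- `ℝⁿ` with its Euclidean norm. -/
abbrev E (n : ℕ) : Type := EuclideanSpace ℝ (Fin n)

/-- `Lip(X, F)`: the real vector space of all Lipschitz maps `X → F`. -/
def Lip (X : Type*) [MetricSpace X] (F : Type*) [NormedAddCommGroup F] [NormedSpace ℝ F] :
    Submodule ℝ (X → F) where
  carrier := {g | ∃ C : ℝ≥0, LipschitzWith C g}
  add_mem' := by
    rintro a b ⟨C, hC⟩ ⟨D, hD⟩
    exact ⟨C + D, hC.add hD⟩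
  zero_mem' := ⟨0, LipschitzWith.const 0⟩
  smul_mem' := by
    rintro c g ⟨C, hC⟩
    exact ⟨‖c‖₊ * C, (lipschitzWith_smul c).comp hC⟩

/-- `Lip_b(X)`: the real vector space of all bounded Lipschitz functions `X → ℝ`. -/
def LipB (X : Type*) [MetricSpace X] : Submodule ℝ (X → ℝ) where
  carrier := {f | (∃ C : ℝ≥0, LipschitzWith C f) ∧ ∃ M : ℝ, ∀ x, |f x| ≤ M}
  add_mem' := by
    rintro a b ⟨⟨C, hC⟩, M, hM⟩ ⟨⟨D, hD⟩, N, hN⟩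
    exact ⟨⟨C + D, hC.add hD⟩, M + N,
      fun x => (abs_add_le (a x) (b x)).trans (add_le_add (hM x) (hN x))⟩
  zero_mem' := ⟨⟨0, LipschitzWith.const 0⟩, 0, fun x => by simp⟩
  smul_mem' := by
    rintro c g ⟨⟨C, hC⟩, M, hM⟩
    refine ⟨⟨‖c‖₊ * C, (lipschitzWith_smul c).comp hC⟩, |c| * M, fun x => ?_⟩
    simpa [abs_mul] using mul_le_mul_of_nonneg_left (hM x) (abs_nonneg c)

section Basic

variable {X : Type*} [MetricSpace X] {Y : Type*} [MetricSpace Y]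
variable {F : Type*} [NormedAddCommGroup F] [NormedSpace ℝ F]

/-- `π ∘ φ` for Lipschitz maps `φ : Y → X` and `π : X → F`. -/
def lipComp (π : Lip X F) (φ : Y → X) (hφ : ∃ C : ℝ≥0, LipschitzWith C φ) : Lip Y F :=
  ⟨π.1 ∘ φ, by
    obtain ⟨C, hC⟩ := π.2
    obtain ⟨D, hD⟩ := hφ
    exact ⟨C * D, hC.comp hD⟩⟩

/-- `f ∘ φ` for a Lipschitz map `φ : Y → X` and a bounded Lipschitz function `f` on `X`. -/
def lipBComp (f : LipB X) (φ : Y → X) (hφ : ∃ C : ℝ≥0, LipschitzWith C φ) : LipB Y :=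
  ⟨f.1 ∘ φ, by
    obtain ⟨⟨C, hC⟩, M, hM⟩ := f.2
    obtain ⟨D, hD⟩ := hφ
    exact ⟨⟨C * D, hC.comp hD⟩, M, fun y => hM (φ y)⟩⟩

/-- A bounded Lipschitz function, regarded as a Lipschitz function. -/
def lipBToLip (f : LipB X) : Lip X ℝ := ⟨f.1, f.2.1⟩

/-- The `j`-th coordinate function of a Lipschitz map `π : X → ℝⁿ`. -/
def lipCoord {n : ℕ} (π : Lip X (E n)) (j : Fin n) : Lip X ℝ :=
  ⟨fun x => π.1 x j, by
    obtain ⟨C, hC⟩ := π.2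
    have h : LipschitzWith 1 fun v : E n => v j := LipschitzWith.of_dist_le_mul fun a b => by
      rw [NNReal.coe_one, one_mul, dist_eq_norm, dist_eq_norm]
      exact PiLp.norm_apply_le (a - b) j
    exact ⟨1 * C, h.comp hC⟩⟩

end Basic

/-- Real-valued functionals on `𝒟ⁿ(X) = Lip_b(X) × Lip(X, ℝⁿ)`. -/
abbrev Functional (X : Type*) [MetricSpace X] (n : ℕ) : Type _ :=
  LipB X → Lip X (E n) → ℝ

section Currents

variable {X : Type*} [MetricSpace X] {n : ℕ}

/-- A functional on `𝒟ⁿ(X)` is multilinear if it is a linear function of `f` and a multilinear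
function of the coordinate functions of `π`. -/
def IsMultilinear (T : Functional X n) : Prop :=
  (∀ π : Lip X (E n), IsLinearMap ℝ fun f : LipB X => T f π) ∧
  ∀ f : LipB X, ∃ M : MultilinearMap ℝ (fun _ : Fin n => Lip X ℝ) ℝ,
    ∀ π : Lip X (E n), T f π = M fun j => lipCoord π j

/-- `L` is compatible: `L(β ∘ π) ≤ Lip(β) L(π)` for all Lipschitz `β : ℝⁿ → ℝⁿ`. (The best
Lipschitz constant of `β` is itself a Lipschitz constant, so it is the same to require the
inequality for all Lipschitz constants `C` of `β`.) -/
def IsCompatible (L : Seminorm ℝ (Lip X (E n))) : Prop :=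
  ∀ (β : Lip (E n) (E n)) (C : ℝ≥0), LipschitzWith C β.1 →
    ∀ π : Lip X (E n), L (lipComp β π.1 π.2) ≤ C * L π

variable [MeasurableSpace X]

/-- The finite Borel measure `μ` satisfies `|T(f, π)| ≤ L(π)ⁿ ∫ |f| dμ` for all `(f, π)`. -/
def MassBound (L : Seminorm ℝ (Lip X (E n))) (T : Functional X n) (μ : Measure X) : Prop :=
  IsFiniteMeasure μ ∧
    ∀ (f : LipB X) (π : Lip X (E n)), |T f π| ≤ L π ^ n * ∫ x, |f.1 x| ∂μ

/-- `L`-currents of dimension `n` in `X`. -/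
structure IsLCurrent (L : Seminorm ℝ (Lip X (E n))) (T : Functional X n) : Prop where
  multilinear : IsMultilinear T
  continuity : ∀ (f : LipB X) (p : ℕ → Lip X (E n)) (π : Lip X (E n)),
    (∀ x, Tendsto (fun i => (p i).1 x) atTop (𝓝 (π.1 x))) →
    (∃ C : ℝ, ∀ i, L (p i) ≤ C) →
    Tendsto (fun i => T f (p i)) atTop (𝓝 (T f π))
  locality : ∀ (f : LipB X) (π : Lip X (E n)) (j : Fin n),
    (∃ U : Set X, IsOpen U ∧ tsupport f.1 ⊆ U ∧ ∃ c : ℝ, ∀ x ∈ U, π.1 x j = c) →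
    T f π = 0
  finiteMass : ∃ μ : Measure X, MassBound L T μ

/-- The mass measure `‖T‖_L`: the smallest finite Borel measure `μ` for which
`|T(f, π)| ≤ L(π)ⁿ ∫ |f| dμ` holds, i.e. the infimum, in the complete lattice of measures,
of all such measures. -/
noncomputable def massMeasure (L : Seminorm ℝ (Lip X (E n))) (T : Functional X n) : Measure X :=
  sInf {μ | MassBound L T μ}

/-- `μ` is concentrated on `S`. -/
def ConcentratedOn (μ : Measure X) (S : Set X) : Prop := μ Sᶜ = 0

variable [BorelSpace X]

/-- `S ⊆ X` is `n`-rectifiable: it is measurable (in the sense of Carathéodory) for the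
`n`-dimensional Hausdorff measure and up to a set of `n`-dimensional Hausdorff measure zero it is
covered by countably many Lipschitz images of Borel subsets of `ℝⁿ`. -/
def IsRectifiableSet (n : ℕ) (S : Set X) : Prop :=
  (Measure.hausdorffMeasure (n : ℝ) : Measure X).toOuterMeasure.IsCaratheodory S ∧
  ∃ (A : ℕ → Set (E n)) (φ : ∀ i, A i → X),
    (∀ i, MeasurableSet (A i)) ∧ (∀ i, ∃ C : ℝ≥0, LipschitzWith C (φ i)) ∧
    (Measure.hausdorffMeasure (n : ℝ) : Measure X) (S \ ⋃ i, Set.range (φ i)) = 0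

/-- A rectifiable `L`-current: its mass measure vanishes on `ℋⁿ`-negligible Borel sets and is
concentrated on an `n`-rectifiable set. -/
structure IsRectifiable (L : Seminorm ℝ (Lip X (E n))) (T : Functional X n) : Prop where
  isLCurrent : IsLCurrent L T
  vanishes : ∀ B : Set X, MeasurableSet B →
    (Measure.hausdorffMeasure (n : ℝ) : Measure X) B = 0 → massMeasure L T B = 0
  concentrated : ∃ S : Set X, IsRectifiableSet n S ∧ ConcentratedOn (massMeasure L T) S

/-- `(K i, φ i)` is a bi-Lipschitz parametrization of `S`: compact sets `K i ⊆ ℝⁿ` and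
bi-Lipschitz embeddings `φ i : K i → X` with pairwise disjoint images, such that `S` and the
union of the images agree up to a set of `ℋⁿ`-measure zero. -/
structure IsBiLipschitzParam (S : Set X) (K : ℕ → Set (E n)) (φ : ∀ i, K i → X) : Prop where
  compact : ∀ i, IsCompact (K i)
  lipschitz : ∀ i, ∃ C : ℝ≥0, LipschitzWith C (φ i)
  antilipschitz : ∀ i, ∃ C : ℝ≥0, AntilipschitzWith C (φ i)
  disjoint : ∀ i j, i ≠ j → Disjoint (Set.range (φ i)) (Set.range (φ j))
  ae_eq : (Measure.hausdorffMeasure (n : ℝ) : Measure X)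
    (symmDiff S (⋃ i, Set.range (φ i))) = 0

end Currents

section Pushforward

/-- The push-forward `φ_# T (f, π) = T(f ∘ φ, π ∘ φ)` under a Lipschitz map `φ : Y → X`. -/
noncomputable def pushforward {X Y : Type*} [MetricSpace X] [MetricSpace Y] {n : ℕ} (φ : Y → X)
    (hφ : ∃ C : ℝ≥0, LipschitzWith C φ) (T : Functional Y n) : Functional X n :=
  fun f π => T (lipBComp f φ hφ) (lipComp π φ hφ)

variable {n : ℕ}

/-- Lipschitz maps from subsets of `ℝⁿ` to finite-dimensional spaces have Lipschitz extensions. -/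
theorem exists_lipschitz_extension {F : Type*} [NormedAddCommGroup F] [NormedSpace ℝ F]
    [FiniteDimensional ℝ F] {K : Set (E n)} (u : Lip K F) :
    ∃ v : Lip (E n) F, ∀ p : K, v.1 p = u.1 p := by
  classical
  obtain ⟨C, hC⟩ := u.2
  have h : LipschitzOnWith C (fun x => if hx : x ∈ K then u.1 ⟨x, hx⟩ else 0) K := by
    intro x hx y hy
    simpa [hx, hy] using hC ⟨x, hx⟩ ⟨y, hy⟩
  obtain ⟨g, hg, hgK⟩ := h.extend_finite_dimension
  exact ⟨⟨g, _, hg⟩, fun p => by simpa using (hgK p.2).symm⟩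

/-- A Lipschitz extension to `ℝⁿ` of a Lipschitz map defined on `K ⊆ ℝⁿ`. -/
noncomputable def lipExtend {F : Type*} [NormedAddCommGroup F] [NormedSpace ℝ F]
    [FiniteDimensional ℝ F] {K : Set (E n)} (u : Lip K F) : Lip (E n) F :=
  (exists_lipschitz_extension u).choose

/-- `⟦θ⟧(g, π) = ∫ θ g det(Dπ) dℒⁿ`, for `π ∈ Lip(ℝⁿ, ℝⁿ)` and `g` a bounded Lipschitz or, more
generally, a bounded Borel function on `ℝⁿ`. -/
noncomputable def euclideanCurrent (θ : E n → ℝ) (g : E n → ℝ) (π : Lip (E n) (E n)) : ℝ :=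
  ∫ p, θ p * g p * (fderiv ℝ π.1 p).det

/-- `⟦θ⟧_K`, the restriction of `⟦θ⟧` to `K` as a functional on `𝒟ⁿ(K)`:
`⟦θ⟧_K(f, π) = ⟦θ⟧(1_K f', π')` where `f'` and `π'` are Lipschitz extensions of `f` and `π`.
For measurable `K` the value does not depend on the choice of the extensions, because two
Lipschitz maps that agree on `K` have the same derivative at almost every point of `K`. -/
noncomputable def euclideanCurrentOn (θ : E n → ℝ) (K : Set (E n)) : Functional K n :=
  fun f π => euclideanCurrent θ (K.indicator (lipExtend (lipBToLip f)).1) (lipExtend π)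

end Pushforward

end LCurrent

namespace LCurrent

/-! ### Bounded Lipschitz functions in `Lᵖ`, and Riesz representation -/

section Density

open scoped ENNReal

variable {X : Type*} [MetricSpace X]

/-! For fixed π the mass inequality bounds f ↦ T(f, π) by an L¹(μ)-norm, so T(f, π) = ∫ f H(π) dμ
with a density H(π) that is multilinear in the coordinates of π and satisfies |H(π)| ≤ L(π)ⁿ almost
everywhere (`exists_isDensity`, `IsDensity.ae_abs_le`). With μ = ‖T‖, the proposition becomes the
splitting of this integral over the disjoint images φᵢ(Kᵢ), which carry ‖T‖. It remains to recognise
the restriction to one image as a push-forward.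

This rests on the behaviour of H. Continuity upgrades the locality axiom to strict locality: H(π) =
0 almost everywhere on level sets of a coordinate (`IsDensity.ae_eq_zero_of_coord_eq`). Hence H is
alternating (`IsDensity.map_eq_zero_of_eq`), and H(π) at almost every point of a set depends only on
the values of π on that set (`IsDensity.ae_eq_of_eqOn`). Approximating a Lipschitz p : ℝⁿ → ℝⁿ by
linear maps on countably many pieces then gives the chain rule H(p ∘ ψ) = det(Dp ∘ ψ) H(ψ) where ψ
sends μ to an absolutely continuous measure (`IsDensity.ae_eq_det_fderiv_mul`).

Let ψ be a Lipschitz extension of φᵢ⁻¹. On φᵢ(Kᵢ) one has π = p ∘ ψ, where p extends π ∘ φᵢ, so the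
restricted current is the push-forward of θᵢ, the Lebesgue density of the ψ-image of H(ψ) μ
restricted to φᵢ(Kᵢ). Mass measures restrict along with currents (`massMeasure_setIntegral`), so
they add up over the images. -/

theorem lipB_continuous (f : LipB X) : Continuous f.1 := by
  obtain ⟨⟨C, hC⟩, -⟩ := f.2
  exact hC.continuous

theorem lip_continuous {F : Type*} [NormedAddCommGroup F] [NormedSpace ℝ F] (f : Lip X F) :
    Continuous f.1 := by
  obtain ⟨C, hC⟩ := f.2
  exact hC.continuous

/-- The product of two bounded Lipschitz functions. -/
def lipBMul (f g : LipB X) : LipB X :=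
  ⟨fun x => f.1 x * g.1 x, by
    obtain ⟨⟨C, hC⟩, M, hM⟩ := f.2
    obtain ⟨⟨D, hD⟩, N, hN⟩ := g.2
    refine ⟨⟨M.toNNReal * D + N.toNNReal * C, LipschitzWith.of_dist_le_mul fun x y => ?_⟩,
      M * N, fun x => ?_⟩
    · have h1 := hC.dist_le_mul x y
      have h2 := hD.dist_le_mul x y
      rw [Real.dist_eq] at h1 h2 ⊢
      have hM0 : 0 ≤ M := (abs_nonneg _).trans (hM x)
      have hN0 : 0 ≤ N := (abs_nonneg _).trans (hN x)
      have e : f.1 x * g.1 x - f.1 y * g.1 y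
          = f.1 x * (g.1 x - g.1 y) + g.1 y * (f.1 x - f.1 y) := by ring
      rw [e, NNReal.coe_add, NNReal.coe_mul, NNReal.coe_mul, Real.coe_toNNReal _ hM0,
        Real.coe_toNNReal _ hN0, add_mul, mul_assoc, mul_assoc]
      refine (abs_add_le _ _).trans (add_le_add ?_ ?_)
      · rw [abs_mul]
        exact mul_le_mul (hM x) h2 (abs_nonneg _) hM0
      · rw [abs_mul]
        exact mul_le_mul (hN y) h1 (abs_nonneg _) hN0
    · rw [abs_mul]
      exact mul_le_mul (hM x) (hN x) (abs_nonneg _) ((abs_nonneg _).trans (hM x))⟩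

/-- The thickened indicator of a set as a bounded Lipschitz function. -/
noncomputable def lipBThickened {δ : ℝ} (hδ : 0 < δ) (s : Set X) : LipB X :=
  ⟨fun x => thickenedIndicator hδ s x,
    ⟨_, LipschitzWith.comp (LipschitzWith.of_dist_le_mul (K := 1) fun a b => by simp [NNReal.dist_eq, Real.dist_eq]) (lipschitzWith_thickenedIndicator hδ s)⟩, 1, fun x => by
      rw [abs_of_nonneg (NNReal.coe_nonneg _)]
      exact_mod_cast thickenedIndicator_le_one hδ s x⟩

variable [MeasurableSpace X] [BorelSpace X]

theorem lipB_memLp (f : LipB X) (p : ℝ≥0∞) (μ : Measure X) [IsFiniteMeasure μ] :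
    MemLp f.1 p μ := by
  obtain ⟨-, M, hM⟩ := f.2
  exact MemLp.of_bound (lipB_continuous f).measurable.aestronglyMeasurable M (.of_forall hM)

theorem lipB_integrable (f : LipB X) (μ : Measure X) [IsFiniteMeasure μ] :
    Integrable f.1 μ := memLp_one_iff_integrable.1 (lipB_memLp f 1 μ)

theorem lipB_integrable_mul (f : LipB X) {μ : Measure X} {h : X → ℝ} (hh : Integrable h μ) :
    Integrable (fun x => f.1 x * h x) μ := by
  obtain ⟨-, M, hM⟩ := f.2
  exact hh.bdd_mul (lipB_continuous f).measurable.aestronglyMeasurable (.of_forall hM)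

/-- Bounded Lipschitz functions are dense in `Lᵖ` of a finite Borel measure. -/
theorem exists_lipB_eLpNorm_sub_le {μ : Measure X} [IsFiniteMeasure μ] {p : ℝ≥0∞} (hp : p ≠ ∞)
    {g : X → ℝ} (hg : MemLp g p μ) {ε : ℝ≥0∞} (hε : ε ≠ 0) :
    ∃ f : LipB X, eLpNorm (g - f.1) p μ ≤ ε := by
  suffices h0 : ∀ (c : ℝ) ⦃s : Set X⦄, MeasurableSet s → μ s < ∞ → ∀ {ε : ℝ≥0∞}, ε ≠ 0 →
      ∃ g : X → ℝ, eLpNorm (g - s.indicator fun _ => c) p μ ≤ ε ∧ g ∈ LipB X by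
    obtain ⟨f, hf, hP⟩ := hg.induction_dense hp (fun f => f ∈ LipB X) h0
      (fun f g hf hg => (LipB X).add_mem hf hg)
      (fun f hf => (lipB_continuous ⟨f, hf⟩).measurable.aestronglyMeasurable) hε
    exact ⟨⟨f, hP⟩, hf⟩
  intro c s hs hμs ε hε
  obtain ⟨η, hη, hη'⟩ := exists_eLpNorm_indicator_le (μ := μ) hp c hε
  have hη2 : (η / 2 : ℝ≥0∞) ≠ 0 := by
    simpa using hη.ne'
  obtain ⟨F, hFs, hF, hsF⟩ := hs.exists_isClosed_sdiff_lt hμs.ne hη2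
  -- `c` times the thickened indicator of `F` differs from `c` times the indicator of `s` only on `s
  -- \ F` and on the thin shell around `F`, by at most `|c|`; each of the two sets gets half of the
  -- measure `η` allowed.
  have h1 := tendsto_measure_cthickening_of_isClosed (μ := μ) (s := F)
    ⟨1, one_pos, measure_ne_top _ _⟩ hF
  have h2 : μ F < μ F + η / 2 := ENNReal.lt_add_right (measure_ne_top _ _) hη2
  have h3 := (h1.eventually (gt_mem_nhds h2)).filter_mono (nhdsWithin_le_nhds (s := Set.Ioi 0))
  obtain ⟨δ, hδ, hδ0⟩ := (h3.and self_mem_nhdsWithin).exists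
  have hδ0 : 0 < δ := hδ0
  refine ⟨_, ?_, (c • lipBThickened hδ0 F).2⟩
  have hsub : F ⊆ Metric.cthickening δ F := Metric.self_subset_cthickening F
  have h4 : μ (Metric.cthickening δ F \ F) ≤ η / 2 := by
    rw [measure_sdiff hsub hF.measurableSet.nullMeasurableSet (measure_ne_top _ _)]
    exact tsub_le_iff_left.2 hδ.le
  refine (eLpNorm_mono_real (g := fun x => ‖((s \ F) ∪ (Metric.cthickening δ F \ F)).indicator
    (fun _ => c) x‖) ?_).trans ((eLpNorm_norm _).trans_le (hη' _ ?_))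
  · intro x
    change ‖c * (thickenedIndicator hδ0 F x : ℝ) - s.indicator (fun _ => c) x‖ ≤ _
    by_cases hxF : x ∈ F
    · rw [thickenedIndicator_one hδ0 F hxF, Set.indicator_of_mem (hFs hxF)]
      simp
    by_cases hxs : x ∈ s
    · rw [Set.indicator_of_mem hxs, Set.indicator_of_mem (.inl ⟨hxs, hxF⟩)]
      have h5 := thickenedIndicator_le_one hδ0 F x
      have h6 : ((thickenedIndicator hδ0 F x : ℝ≥0) : ℝ) ≤ 1 := by exact_mod_cast h5
      have h7 : |(thickenedIndicator hδ0 F x : ℝ) - 1| ≤ 1 := by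
        rw [abs_le]; constructor <;> linarith [(thickenedIndicator hδ0 F x).2]
      calc _ = ‖c * ((thickenedIndicator hδ0 F x : ℝ) - 1)‖ := by rw [mul_sub, mul_one]
        _ = |c| * |(thickenedIndicator hδ0 F x : ℝ) - 1| := by rw [norm_mul]; rfl
        _ ≤ |c| * 1 := by gcongr
        _ = _ := by rw [mul_one]; rfl
    · rw [Set.indicator_of_notMem hxs]
      by_cases hxt : x ∈ Metric.cthickening δ F
      · rw [Set.indicator_of_mem (.inr ⟨hxt, hxF⟩)]
        have h5 := thickenedIndicator_le_one hδ0 F x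
        have h6 : ((thickenedIndicator hδ0 F x : ℝ≥0) : ℝ) ≤ 1 := by exact_mod_cast h5
        rw [sub_zero, norm_mul]
        refine mul_le_of_le_one_right (norm_nonneg _) ?_
        rwa [Real.norm_of_nonneg (NNReal.coe_nonneg _)]
      · rw [thickenedIndicator_zero hδ0 F fun h => hxt (Metric.thickening_subset_cthickening _ _ h)]
        simp
  · calc _ ≤ μ (s \ F) + μ (Metric.cthickening δ F \ F) := measure_union_le _ _
      _ ≤ η / 2 + η / 2 := add_le_add hsF.le h4
      _ = η := ENNReal.add_halves _

theorem exists_lipB_tendsto {μ : Measure X} [IsFiniteMeasure μ] {g : X → ℝ}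
    (hg : Integrable g μ) :
    ∃ f : ℕ → LipB X, Tendsto (fun k => ∫ x, |g x - (f k).1 x| ∂μ) atTop (𝓝 0) := by
  have h : ∀ k : ℕ, ∃ f : LipB X, eLpNorm (g - f.1) 1 μ ≤ ENNReal.ofReal (1 / ((k : ℝ) + 1)) :=
    fun k => exists_lipB_eLpNorm_sub_le ENNReal.one_ne_top (memLp_one_iff_integrable.2 hg)
      (ENNReal.ofReal_pos.2 (by positivity)).ne'
  choose f hf using h
  refine ⟨f, squeeze_zero (fun k => integral_nonneg fun _ => abs_nonneg _) (fun k => ?_)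
    tendsto_one_div_add_atTop_nhds_zero_nat⟩
  have h1 := hf k
  rw [eLpNorm_one_eq_lintegral_enorm, ← ofReal_integral_norm_eq_lintegral_enorm
    (hg.sub (lipB_integrable (f k) μ))] at h1
  exact (ENNReal.ofReal_le_ofReal_iff (by positivity)).1 h1

/-- If `f ↦ ∫ f h dμ` is bounded on bounded Lipschitz functions by `c ∫ |f| dν`, then
`|h| μ ≤ c ν`. -/
theorem withDensity_enorm_le {μ ν : Measure X} [IsFiniteMeasure ν] {h : X → ℝ}
    (hh : Integrable h μ) {c : ℝ} (hc : 0 ≤ c)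
    (H : ∀ f : LipB X, |∫ x, f.1 x * h x ∂μ| ≤ c * ∫ x, |f.1 x| ∂ν) :
    μ.withDensity (fun x => ‖h x‖ₑ) ≤ ENNReal.ofReal c • ν := by
  -- A measurable representative is needed to make the sign of `h` a measurable function.
  wlog hm : StronglyMeasurable h generalizing h
  · have h1 := this (h := hh.1.mk h) (hh.congr hh.1.ae_eq_mk) (fun f => by
      rw [← integral_congr_ae (hh.1.ae_eq_mk.mono fun x hx => by
        simp only [hx] : (fun x => f.1 x * h x) =ᵐ[μ] fun x => f.1 x * hh.1.mk h x)]
      exact H f) hh.1.stronglyMeasurable_mk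
    rwa [← withDensity_congr_ae (hh.1.ae_eq_mk.mono fun x hx => by simp only [hx] :
      (fun x => ‖h x‖ₑ) =ᵐ[μ] fun x => ‖hh.1.mk h x‖ₑ)] at h1
  have : IsFiniteMeasure (μ.withDensity fun x => ‖h x‖ₑ) :=
    isFiniteMeasure_withDensity hh.2.ne
  refine Measure.le_iff.2 fun A hA => ?_
  -- Approximating the sign of `h` on `A` in L¹(`ρ`) controls the errors against |h| μ and against
  -- `ν` by the same sequence, even if these measures are mutually singular.
  set ρ := μ.withDensity (fun x => ‖h x‖ₑ) + ν with hρ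
  let g : X → ℝ := A.indicator fun x => if 0 ≤ h x then 1 else -1
  have hgm : Measurable g :=
    (Measurable.ite (measurableSet_le measurable_const hm.measurable) measurable_const
      measurable_const).indicator hA
  have hgb : ∀ x, ‖g x‖ ≤ 1 := by
    intro x
    by_cases hx : x ∈ A
    · simp only [g, Set.indicator_of_mem hx]
      split_ifs <;> simp
    · simp [g, hx]
  have hgi : Integrable g ρ := .of_bound hgm.aestronglyMeasurable 1 (.of_forall hgb)
  obtain ⟨f, hf⟩ := exists_lipB_tendsto hgi
  have habs : ∀ k, Integrable (fun x => |g x - (f k).1 x|) ρ :=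
    fun k => (hgi.sub (lipB_integrable (f k) ρ)).abs
  have hgh : Integrable (fun x => g x * h x) μ :=
    hh.bdd_mul hgm.aestronglyMeasurable (.of_forall hgb)
  have hint : ∀ k, ∫ x, |g x - (f k).1 x| ∂ρ
      = ∫ x, |g x - (f k).1 x| * |h x| ∂μ + ∫ x, |g x - (f k).1 x| ∂ν := by
    intro k
    rw [hρ, integral_add_measure ((habs k).mono_measure (Measure.le_add_right le_rfl))
      ((habs k).mono_measure (Measure.le_add_left le_rfl)),
      integral_withDensity_eq_integral_toReal_smul (by fun_prop) (.of_forall fun x => by simp)]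
    congr 2
    ext x
    simp [mul_comm]
  have hlim1 : Tendsto (fun k => ∫ x, |g x - (f k).1 x| * |h x| ∂μ) atTop (𝓝 0) :=
    squeeze_zero (fun k => integral_nonneg fun x => by positivity) (fun k => by
      rw [hint k]; linarith [integral_nonneg (μ := ν) (f := fun x => |g x - (f k).1 x|)
        fun x => abs_nonneg _]) hf
  have hlim2 : Tendsto (fun k => ∫ x, |g x - (f k).1 x| ∂ν) atTop (𝓝 0) :=
    squeeze_zero (fun k => integral_nonneg fun x => by positivity) (fun k => by
      rw [hint k]; linarith [integral_nonneg (μ := μ) (f := fun x => |g x - (f k).1 x| * |h x|)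
        fun x => mul_nonneg (abs_nonneg _) (abs_nonneg _)]) hf
  have key : ∀ k, ∫ x, g x * h x ∂μ ≤ ∫ x, |g x - (f k).1 x| * |h x| ∂μ
      + c * (∫ x, |g x| ∂ν + ∫ x, |g x - (f k).1 x| ∂ν) := by
    intro k
    have e1 : ∫ x, g x * h x ∂μ
        = ∫ x, (g x - (f k).1 x) * h x ∂μ + ∫ x, (f k).1 x * h x ∂μ := by
      rw [← integral_add]
      · congr 1; ext x; ring
      · exact (hgh.sub (lipB_integrable_mul (f k) hh)).congr (.of_forall fun x => by
          simp only [Pi.sub_apply]; ring)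
      · exact lipB_integrable_mul (f k) hh
    have e2 : ∫ x, (g x - (f k).1 x) * h x ∂μ ≤ ∫ x, |g x - (f k).1 x| * |h x| ∂μ := by
      refine (le_abs_self _).trans ((abs_integral_le_integral_abs).trans_eq ?_)
      simp_rw [abs_mul]
    have e3 : ∫ x, |(f k).1 x| ∂ν ≤ ∫ x, |g x| ∂ν + ∫ x, |g x - (f k).1 x| ∂ν := by
      have i1 : Integrable (fun x => |g x|) ν :=
        (hgi.mono_measure (Measure.le_add_left le_rfl)).abs
      have i2 := (habs k).mono_measure (Measure.le_add_left le_rfl : ν ≤ ρ)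
      rw [← integral_add i1 i2]
      refine integral_mono (lipB_integrable (f k) ν).abs (i1.add i2) fun x => ?_
      have := abs_sub_abs_le_abs_sub ((f k).1 x) (g x)
      rw [abs_sub_comm] at this
      simp only
      linarith
    have e4 := (le_abs_self _).trans (H (f k))
    have e5 := mul_le_mul_of_nonneg_left e3 hc
    linarith
  have hfin : ∫ x, g x * h x ∂μ ≤ c * ∫ x, |g x| ∂ν := by
    refine ge_of_tendsto (x := atTop) (?_ : Tendsto (fun k =>
      ∫ x, |g x - (f k).1 x| * |h x| ∂μ
      + c * (∫ x, |g x| ∂ν + ∫ x, |g x - (f k).1 x| ∂ν)) atTop _) (.of_forall key)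
    simpa using hlim1.add ((hlim2.const_add (∫ x, |g x| ∂ν)).const_mul c)
  have h1 : ∫ x, g x * h x ∂μ = ∫ x in A, |h x| ∂μ := by
    rw [← integral_indicator hA]
    congr 1
    ext x
    by_cases hx : x ∈ A <;>
      simp only [g, hx, Set.indicator_of_mem, Set.indicator_of_notMem, not_false_eq_true, zero_mul]
    split_ifs with h0
    · rw [abs_of_nonneg h0, one_mul]
    · rw [abs_of_neg (not_le.1 h0), neg_one_mul]
  have h2 : ∫ x, |g x| ∂ν ≤ ν.real A := by
    rw [← integral_indicator_one hA]
    refine integral_mono (hgi.mono_measure (Measure.le_add_left le_rfl)).abs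
      ((integrable_const 1).indicator hA) fun x => ?_
    by_cases hx : x ∈ A
    · simpa [hx] using hgb x
    · simp [hx, g]
  rw [withDensity_apply _ hA, Measure.smul_apply, smul_eq_mul,
    ← ofReal_integral_norm_eq_lintegral_enorm hh.integrableOn, ← ofReal_measureReal,
    ← ENNReal.ofReal_mul hc]
  exact ENNReal.ofReal_le_ofReal (by
    simp_rw [Real.norm_eq_abs]
    rw [← h1]; exact hfin.trans (mul_le_mul_of_nonneg_left h2 hc))

theorem ae_abs_le_of_forall_lipB {μ : Measure X} [IsFiniteMeasure μ] {h : X → ℝ}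
    (hh : Integrable h μ) {c : ℝ} (hc : 0 ≤ c)
    (H : ∀ f : LipB X, |∫ x, f.1 x * h x ∂μ| ≤ c * ∫ x, |f.1 x| ∂μ) :
    ∀ᵐ x ∂μ, |h x| ≤ c := by
  have h1 := withDensity_enorm_le hh hc H
  refine ae_le_of_forall_setIntegral_le hh.abs (integrable_const c) fun s hs _ => ?_
  have h2 := Measure.le_iff.1 h1 s hs
  rw [withDensity_apply _ hs, Measure.smul_apply, smul_eq_mul,
    ← ofReal_integral_norm_eq_lintegral_enorm hh.integrableOn, ← ofReal_measureReal,
    ← ENNReal.ofReal_mul hc, ENNReal.ofReal_le_ofReal_iff (by positivity)] at h2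
  simpa [mul_comm] using h2

theorem ae_eq_zero_of_forall_lipB {μ : Measure X} [IsFiniteMeasure μ] {h : X → ℝ}
    (hh : Integrable h μ) (H : ∀ f : LipB X, ∫ x, f.1 x * h x ∂μ = 0) : h =ᵐ[μ] 0 := by
  filter_upwards [ae_abs_le_of_forall_lipB hh le_rfl fun f => by simp [H f]] with x hx
  exact abs_nonpos_iff.1 hx

/-- A linear functional on bounded Lipschitz functions which is bounded by `c ∫ |f| dμ` has an
integrable density with respect to `μ`. -/
theorem exists_density {μ : Measure X} [IsFiniteMeasure μ] {ℓ : LipB X →ₗ[ℝ] ℝ} {c : ℝ}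
    (hc : 0 ≤ c) (H : ∀ f : LipB X, |ℓ f| ≤ c * ∫ x, |f.1 x| ∂μ) :
    ∃ h : Lp ℝ 1 μ, ∀ f : LipB X, ℓ f = ∫ x, f.1 x * h x ∂μ := by
  -- As `μ` is finite, the L¹-bound implies an L²-bound, and the Riesz theorem in the Hilbert space
  -- L² replaces the duality of L¹ and L^∞.
  let e : LipB X →ₗ[ℝ] Lp ℝ 2 μ :=
    { toFun := fun f => (lipB_memLp f 2 μ).toLp
      map_add' := fun f g => rfl
      map_smul' := fun a f => rfl }
  have he : DenseRange e := by
    refine fun u => Metric.mem_closure_iff.2 fun ε hε => ?_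
    obtain ⟨f, hf⟩ := exists_lipB_eLpNorm_sub_le (p := 2) (by simp) (Lp.memLp u)
      (ENNReal.ofReal_pos.2 (half_pos hε)).ne'
    refine ⟨e f, ⟨f, rfl⟩, ?_⟩
    rw [Lp.dist_def]
    have h1 : eLpNorm (⇑u - ⇑(e f)) 2 μ = eLpNorm (⇑u - f.1) 2 μ :=
      eLpNorm_congr_ae ((lipB_memLp f 2 μ).coeFn_toLp.mono fun x hx => by
        simp only [Pi.sub_apply]
        exact congrArg _ hx)
    rw [h1]
    exact (ENNReal.toReal_le_of_le_ofReal (by positivity) hf).trans_lt (half_lt_self hε)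
  have hb : ∃ C : ℝ, ∀ f, ‖ℓ f‖ ≤ C * ‖e f‖ := by
    refine ⟨c * (μ Set.univ ^ (1 / (1 : ℝ≥0∞).toReal - 1 / (2 : ℝ≥0∞).toReal)).toReal,
      fun f => ?_⟩
    have h1 : ∫ x, |f.1 x| ∂μ = (eLpNorm f.1 1 μ).toReal := by
      rw [eLpNorm_one_eq_lintegral_enorm, ← integral_norm_eq_lintegral_enorm
        (lipB_integrable f μ).1]
      rfl
    have h2 := eLpNorm_le_eLpNorm_mul_rpow_measure_univ (μ := μ) (p := 1) (q := 2)
      (by norm_num) (lipB_integrable f μ).1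
    have h3 : ‖e f‖ = (eLpNorm f.1 2 μ).toReal := Lp.norm_toLp _ (lipB_memLp f 2 μ)
    have hfin : μ Set.univ ^ (1 / (1 : ℝ≥0∞).toReal - 1 / (2 : ℝ≥0∞).toReal) ≠ ∞ :=
      ENNReal.rpow_ne_top_of_nonneg (by norm_num) (measure_ne_top _ _)
    have h4 := ENNReal.toReal_mono (ENNReal.mul_ne_top (lipB_memLp f 2 μ).2.ne hfin) h2
    rw [ENNReal.toReal_mul] at h4
    calc ‖ℓ f‖ ≤ c * ∫ x, |f.1 x| ∂μ := H f
      _ ≤ c * ((eLpNorm f.1 2 μ).toReal * _) := by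
        rw [h1]; exact mul_le_mul_of_nonneg_left h4 hc
      _ = _ := by rw [h3]; ring
  let w : Lp ℝ 2 μ := (InnerProductSpace.toDual ℝ (Lp ℝ 2 μ)).symm (ℓ.extendOfNorm e)
  have hw : MemLp w 1 μ := (Lp.memLp w).mono_exponent (by norm_num)
  refine ⟨hw.toLp, fun f => ?_⟩
  rw [← LinearMap.extendOfNorm_eq he hb f, ← InnerProductSpace.toDual_symm_apply, L2.inner_def]
  refine integral_congr_ae ?_
  filter_upwards [(lipB_memLp f 2 μ).coeFn_toLp, hw.coeFn_toLp] with x h1 h2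
  rw [h2]
  have h3 : (e f : X → ℝ) x = f.1 x := h1
  rw [h3]
  simp only [w, RCLike.inner_apply, conj_trivial]

end Density

/-! ### The multilinear density and the mass measure -/

section Mass

open scoped ENNReal

variable {X : Type*} [MetricSpace X] {n : ℕ}

/-- The Lipschitz map to `ℝⁿ` with given coordinate functions. -/
noncomputable def lipOfCoord (u : Fin n → Lip X ℝ) : Lip X (E n) :=
  ⟨fun x => WithLp.toLp 2 fun j => (u j).1 x, by
    choose C hC using fun j => (u j).2
    have h : LipschitzWith (∑ j, C j) fun x j => (u j).1 x :=
      LipschitzWith.of_dist_le_mul fun x y => (dist_pi_le_iff (by positivity)).2 fun j =>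
        ((hC j).dist_le_mul x y).trans (by
          gcongr
          exact_mod_cast Finset.single_le_sum (fun _ _ => zero_le) (Finset.mem_univ j))
    exact ⟨_, (PiLp.lipschitzWith_toLp 2 _).comp h⟩⟩

variable [MeasurableSpace X] [BorelSpace X]

/-- `H` is the multilinear density of the functional `T` with respect to `μ`. -/
def IsDensity (T : Functional X n) (μ : Measure X)
    (H : MultilinearMap ℝ (fun _ : Fin n => Lip X ℝ) (Lp ℝ 1 μ)) : Prop :=
  ∀ (f : LipB X) (π : Lip X (E n)), T f π = ∫ x, f.1 x * H (lipCoord π) x ∂μ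

theorem lp_eq_of_forall_lipB {μ : Measure X} [IsFiniteMeasure μ] {g h : Lp ℝ 1 μ}
    (H : ∀ f : LipB X, ∫ x, f.1 x * g x ∂μ = ∫ x, f.1 x * h x ∂μ) : g = h := by
  have h1 := ae_eq_zero_of_forall_lipB
    ((L1.integrable_coeFn g).sub (L1.integrable_coeFn h)) fun f => by
      simp only [Pi.sub_apply, mul_sub]
      rw [integral_sub (lipB_integrable_mul f (L1.integrable_coeFn g))
        (lipB_integrable_mul f (L1.integrable_coeFn h)), H f, sub_self]
  exact Lp.ext (h1.mono fun x hx => sub_eq_zero.1 hx)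

/-- Bounded Lipschitz functions determine a density uniquely, so multilinearity of `T` in the
coordinates passes to the densities chosen for each π separately. -/
theorem exists_isDensity {L : Seminorm ℝ (Lip X (E n))} {T : Functional X n}
    (hT : IsMultilinear T) {μ : Measure X} (hμ : MassBound L T μ) :
    ∃ H : MultilinearMap ℝ (fun _ : Fin n => Lip X ℝ) (Lp ℝ 1 μ), IsDensity T μ H := by
  have := hμ.1
  have h1 : ∀ π : Lip X (E n), ∃ h : Lp ℝ 1 μ, ∀ f : LipB X, T f π = ∫ x, f.1 x * h x ∂μ :=
    fun π => exists_density (ℓ := (hT.1 π).mk') (pow_nonneg (apply_nonneg L π) n)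
      fun f => hμ.2 f π
  choose h hh using h1
  refine ⟨⟨fun u => h (lipOfCoord u), fun u i a b => ?_, fun u i c a => ?_⟩, fun f π => hh π f⟩
  · refine lp_eq_of_forall_lipB fun f => ?_
    obtain ⟨M, hM⟩ := hT.2 f
    rw [← hh, hM, integral_congr_ae ((Lp.coeFn_add _ _).mono fun x hx => by
      rw [hx, Pi.add_apply, mul_add]), integral_add
      (lipB_integrable_mul f (L1.integrable_coeFn _))
      (lipB_integrable_mul f (L1.integrable_coeFn _)), ← hh, ← hh, hM, hM]
    exact M.map_update_add u i a b
  · refine lp_eq_of_forall_lipB fun f => ?_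
    obtain ⟨M, hM⟩ := hT.2 f
    rw [← hh, hM, integral_congr_ae ((Lp.coeFn_smul _ _).mono fun x hx => by
      rw [hx, Pi.smul_apply, smul_eq_mul, mul_left_comm]), integral_const_mul, ← hh, hM]
    exact M.map_update_smul u i c a

/-- The mass measure of a functional of finite mass satisfies the mass inequality. -/
theorem massBound_massMeasure {L : Seminorm ℝ (Lip X (E n))} {T : Functional X n}
    (hT : IsMultilinear T) {μ : Measure X} (hμ : MassBound L T μ) :
    MassBound L T (massMeasure L T) := by
  have := hμ.1
  have hle : massMeasure L T ≤ μ := sInf_le hμ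
  have hfin : IsFiniteMeasure (massMeasure L T) := isFiniteMeasure_of_le μ hle
  refine ⟨hfin, fun f π => ?_⟩
  obtain ⟨H, hH⟩ := exists_isDensity hT hμ
  set h := H (lipCoord π) with hh
  have hint : Integrable h μ := L1.integrable_coeFn h
  set c := L π ^ n with hc
  have hc0 : 0 ≤ c := pow_nonneg (apply_nonneg L π) n
  -- The bound for T(·, π) is equivalent to the inequality |h| μ ≤ c ν between measures, and such an
  -- inequality survives the infimum over ν.
  have hV : ∀ ν, MassBound L T ν →
      μ.withDensity (fun x => ‖h x‖ₑ) ≤ ENNReal.ofReal c • ν := fun ν hν => by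
    have := hν.1
    exact withDensity_enorm_le hint hc0 fun f => by rw [← hH f π]; exact hν.2 f π
  have hVm : μ.withDensity (fun x => ‖h x‖ₑ) ≤ ENNReal.ofReal c • massMeasure L T := by
    -- The infimum is reached after dividing by `c`; for `c = 0` the measure |h| μ is already zero.
    rcases hc0.eq_or_lt with h0 | h0
    · simpa [← h0] using hV μ hμ
    have hc1 : ENNReal.ofReal c ≠ 0 := (ENNReal.ofReal_pos.2 h0).ne'
    have h1 : (ENNReal.ofReal c)⁻¹ • μ.withDensity (fun x => ‖h x‖ₑ) ≤ massMeasure L T := by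
      refine le_sInf fun ν hν => Measure.le_iff.2 fun s hs => ?_
      have h2 := Measure.le_iff.1 (hV ν hν) s hs
      rw [Measure.smul_apply, smul_eq_mul] at h2 ⊢
      rwa [ENNReal.inv_mul_le_iff hc1 ENNReal.ofReal_ne_top]
    refine Measure.le_iff.2 fun s hs => ?_
    have h2 := Measure.le_iff.1 h1 s hs
    rw [Measure.smul_apply, smul_eq_mul] at h2 ⊢
    rwa [ENNReal.inv_mul_le_iff hc1 ENNReal.ofReal_ne_top] at h2
  have hfin2 : IsFiniteMeasure (ENNReal.ofReal c • massMeasure L T) :=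
    Measure.smul_finite _ ENNReal.ofReal_ne_top
  calc |T f π| = |∫ x, f.1 x * h x ∂μ| := by rw [hH f π]
    _ ≤ ∫ x, |f.1 x| * |h x| ∂μ := by
      simpa only [abs_mul] using abs_integral_le_integral_abs (f := fun x => f.1 x * h x)
    _ = ∫ x, |f.1 x| ∂(μ.withDensity fun x => ‖h x‖ₑ) := by
      rw [integral_withDensity_eq_integral_toReal_smul₀ hint.1.enorm (.of_forall fun x => by simp)]
      simp [mul_comm]
    _ ≤ ∫ x, |f.1 x| ∂(ENNReal.ofReal c • massMeasure L T) :=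
      integral_mono_measure hVm (.of_forall fun x => abs_nonneg _)
        (lipB_integrable f _).abs
    _ = c * ∫ x, |f.1 x| ∂massMeasure L T := by
      rw [integral_smul_measure, ENNReal.toReal_ofReal hc0, smul_eq_mul]

theorem IsDensity.ae_abs_le {L : Seminorm ℝ (Lip X (E n))} {T : Functional X n} {μ : Measure X}
    {H : MultilinearMap ℝ (fun _ : Fin n => Lip X ℝ) (Lp ℝ 1 μ)} (hH : IsDensity T μ H)
    (hμ : MassBound L T μ) (u : Fin n → Lip X ℝ) :
    ∀ᵐ x ∂μ, |H u x| ≤ L (lipOfCoord u) ^ n := by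
  have := hμ.1
  exact ae_abs_le_of_forall_lipB (L1.integrable_coeFn _) (pow_nonneg (apply_nonneg L _) n)
    fun f => by
      have h := hμ.2 f (lipOfCoord u)
      rw [hH] at h
      exact h

/-- The continuity axiom extends to integrable functions `g`. -/
theorem IsDensity.tendsto_integral {L : Seminorm ℝ (Lip X (E n))} {T : Functional X n}
    (hT : IsLCurrent L T) {μ : Measure X}
    {H : MultilinearMap ℝ (fun _ : Fin n => Lip X ℝ) (Lp ℝ 1 μ)} (hH : IsDensity T μ H)
    (hμ : MassBound L T μ) {g : X → ℝ} (hg : Integrable g μ)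
    {p : ℕ → Lip X (E n)} {π : Lip X (E n)}
    (hp : ∀ x, Tendsto (fun i => (p i).1 x) atTop (𝓝 (π.1 x)))
    {C : ℝ} (hC : ∀ i, L (p i) ≤ C) :
    Tendsto (fun i => ∫ x, g x * H (lipCoord (p i)) x ∂μ) atTop
      (𝓝 (∫ x, g x * H (lipCoord π) x ∂μ)) := by
  have := hμ.1
  obtain ⟨f, hf⟩ := exists_lipB_tendsto hg
  -- `L` is not assumed lower semicontinuous, so `L π` may exceed `C`. A bound common to the
  -- sequence and its limit makes the error of replacing `g` by a Lipschitz function uniform.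
  set D := max C (L π)
  have hD : 0 ≤ D ^ n := pow_nonneg ((apply_nonneg L π).trans (le_max_right _ _)) n
  have hbd : ∀ q : Lip X (E n), L q ≤ D → ∀ᵐ x ∂μ, ‖H (lipCoord q) x‖ ≤ D ^ n := fun q hq =>
    (hH.ae_abs_le hμ (lipCoord q)).mono fun x hx =>
      hx.trans (pow_le_pow_left₀ (apply_nonneg L _) hq n)
  have hest : ∀ q : Lip X (E n), L q ≤ D → ∀ k,
      |∫ x, g x * H (lipCoord q) x ∂μ - T (f k) q| ≤ D ^ n * ∫ x, |g x - (f k).1 x| ∂μ := by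
    intro q hq k
    have hm := (L1.integrable_coeFn (H (lipCoord q))).1
    have hi := hg.sub (lipB_integrable (f k) μ)
    rw [hH, ← integral_sub (hg.mul_bdd hm (hbd q hq))
      ((lipB_integrable (f k) μ).mul_bdd hm (hbd q hq)), ← integral_const_mul]
    refine abs_integral_le_integral_abs.trans (integral_mono_ae
      ((hi.mul_bdd hm (hbd q hq)).abs.congr (.of_forall fun x => by
        simp only [Pi.sub_apply, sub_mul])) (hi.abs.const_mul _) ?_)
    filter_upwards [hbd q hq] with x hx
    rw [← sub_mul, abs_mul, mul_comm]
    exact mul_le_mul_of_nonneg_right hx (abs_nonneg _)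
  refine Metric.tendsto_atTop.2 fun ε hε => ?_
  have hf' := hf.const_mul (D ^ n)
  rw [mul_zero] at hf'
  obtain ⟨k, hk⟩ := (hf'.eventually (gt_mem_nhds (show (0 : ℝ) < ε / 3 by positivity))).exists
  obtain ⟨N, hN⟩ := Metric.tendsto_atTop.1 (hT.continuity (f k) p π hp ⟨C, hC⟩) (ε / 3)
    (by positivity)
  refine ⟨N, fun i hi => ?_⟩
  have h1 := hest (p i) ((hC i).trans (le_max_left _ _)) k
  have h2 := hest π (le_max_right _ _) k
  have h3 := hN i hi
  rw [Real.dist_eq] at h3 ⊢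
  rw [abs_lt] at h3 ⊢
  have h4 := abs_le.1 (h1.trans hk.le)
  have h5 := abs_le.1 (h2.trans hk.le)
  have h6 := abs_lt.1 (h1.trans_lt hk)
  constructor <;> linarith [h3.1, h3.2, h4.1, h4.2, h5.1, h5.2, h6.1, h6.2]

end Mass

/-! ### Strict locality and the alternating property -/

section Locality

variable {X : Type*} [MetricSpace X] {n : ℕ}

/-- Composing the coordinate functions with `C`-Lipschitz functions increases a compatible
Lipschitz norm at most by the factor `C`. -/
theorem IsCompatible.lipOfCoord_comp_le {L : Seminorm ℝ (Lip X (E n))} (hL : IsCompatible L)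
    {C : ℝ≥0} {g : Fin n → Lip ℝ ℝ} (hg : ∀ j, LipschitzWith C (g j).1)
    (u : Fin n → Lip X ℝ) :
    L (lipOfCoord fun j => lipComp (g j) (u j).1 (u j).2) ≤ C * L (lipOfCoord u) := by
  have hc : ∀ j : Fin n, ∃ C : ℝ≥0, LipschitzWith C fun x : E n => x j := fun j =>
    (lipCoord (⟨id, 1, LipschitzWith.id⟩ : Lip (E n) (E n)) j).2
  refine hL (lipOfCoord fun j => lipComp (g j) (fun x : E n => x j) (hc j)) C ?_ (lipOfCoord u)
  refine LipschitzWith.of_dist_le_mul fun x y => ?_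
  have hC : (C : ℝ) = √((C : ℝ) ^ 2) := (Real.sqrt_sq C.2).symm
  rw [EuclideanSpace.dist_eq, EuclideanSpace.dist_eq, hC, ← Real.sqrt_mul (sq_nonneg _),
    Finset.mul_sum]
  refine Real.sqrt_le_sqrt (Finset.sum_le_sum fun j _ => ?_)
  rw [← mul_pow]
  exact pow_le_pow_left₀ dist_nonneg ((hg j).dist_le_mul (x j) (y j)) 2

theorem tendsto_lipOfCoord {u : ℕ → Fin n → Lip X ℝ} {v : Fin n → Lip X ℝ} {x : X}
    (h : ∀ j, Tendsto (fun k => (u k j).1 x) atTop (𝓝 ((v j).1 x))) :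
    Tendsto (fun k => (lipOfCoord (u k)).1 x) atTop (𝓝 ((lipOfCoord v).1 x)) :=
  ((PiLp.continuous_toLp 2 _).tendsto _).comp (tendsto_pi_nhds.2 h)

/-- The `1`-Lipschitz function which collapses `[c - ε, c + ε]` to `c`. -/
noncomputable def collapse (c ε : ℝ) (t : ℝ) : ℝ := c + max (t - c - ε) 0 + min (t - c + ε) 0

theorem lipschitzWith_collapse (c : ℝ) {ε : ℝ} (hε : 0 ≤ ε) : LipschitzWith 1 (collapse c ε) := by
  refine LipschitzWith.of_dist_le_mul fun a b => ?_
  rw [NNReal.coe_one, one_mul, Real.dist_eq, Real.dist_eq, collapse, collapse]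
  rcases abs_cases (a - b) with ⟨h, h'⟩ | ⟨h, h'⟩ <;> rw [h, abs_le] <;>
  rcases max_cases (a - c - ε) 0 with h1 | h1 <;> rcases max_cases (b - c - ε) 0 with h2 | h2 <;>
  rcases min_cases (a - c + ε) 0 with h3 | h3 <;> rcases min_cases (b - c + ε) 0 with h4 | h4 <;>
  constructor <;> linarith

theorem collapse_eq {c ε t : ℝ} (h : |t - c| ≤ ε) : collapse c ε t = c := by
  rw [abs_le] at h
  rw [collapse, max_eq_right (by linarith), min_eq_right (by linarith)]
  ring

theorem tendsto_collapse (c t : ℝ) {ε : ℕ → ℝ} (hε : Tendsto ε atTop (𝓝 0)) :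
    Tendsto (fun k => collapse c (ε k) t) atTop (𝓝 t) := by
  have h : Continuous fun e => collapse c e t := by unfold collapse; fun_prop
  have h0 : collapse c 0 t = t := by
    rw [collapse, sub_zero, add_zero, add_assoc, max_add_min]
    ring
  have h1 :=  (h.tendsto 0).comp hε
  rw [h0] at h1
  exact h1

/-- The `1`-Lipschitz function `t ↦ dist (t, (k + 1)⁻¹ ℤ)`. -/
noncomputable def distGrid (k : ℕ) (t : ℝ) : ℝ :=
  Metric.infDist ((k + 1) * t) (Set.range ((↑) : ℤ → ℝ)) / (k + 1)

theorem lipschitzWith_distGrid (k : ℕ) : LipschitzWith 1 (distGrid k) := by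
  refine LipschitzWith.of_dist_le_mul fun a b => ?_
  have h := (Metric.lipschitz_infDist_pt (Set.range ((↑) : ℤ → ℝ))).dist_le_mul
    ((k + 1) * a) ((k + 1) * b)
  have hk : (0 : ℝ) < k + 1 := by positivity
  rw [Real.dist_eq, Real.dist_eq, ← mul_sub, abs_mul, abs_of_pos hk] at h
  rw [Real.dist_eq, Real.dist_eq, distGrid, distGrid, ← sub_div, abs_div, abs_of_pos hk,
    div_le_iff₀ hk]
  simpa [mul_comm] using h

theorem tendsto_distGrid (t : ℝ) : Tendsto (fun k => distGrid k t) atTop (𝓝 0) := by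
  refine squeeze_zero (fun k => div_nonneg Metric.infDist_nonneg (by positivity)) (fun k => ?_)
    tendsto_one_div_add_atTop_nhds_zero_nat
  refine div_le_div_of_nonneg_right ?_ (by positivity)
  refine (Metric.infDist_le_dist_of_mem (Set.mem_range_self ⌊(k + 1) * t⌋)).trans ?_
  rw [Real.dist_eq, Int.self_sub_floor, abs_of_nonneg (Int.fract_nonneg _)]
  exact (Int.fract_lt_one _).le

/-- The nearest grid point lies either to the right or to the left of `t`. Thus one of the two
perturbations of `t` takes values in a countable set, which is what strict locality can exploit. -/
theorem exists_add_or_sub_distGrid_eq (k : ℕ) (t : ℝ) :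
    ∃ m : ℤ, t + distGrid k t = m / (k + 1) ∨ t - distGrid k t = m / (k + 1) := by
  obtain ⟨_, ⟨m, rfl⟩, hm⟩ := Int.isClosedEmbedding_coe_real.isClosed_range.exists_infDist_eq_dist
    ⟨_, Set.mem_range_self (0 : ℤ)⟩ (((k : ℝ) + 1) * t)
  have hk : (0 : ℝ) < k + 1 := by positivity
  refine ⟨m, ?_⟩
  rw [distGrid, hm, Real.dist_eq]
  rcases abs_cases ((k + 1) * t - m) with ⟨h, -⟩ | ⟨h, -⟩ <;> rw [h]
  · right
    field_simp
    ring
  · left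
    field_simp
    ring

variable [MeasurableSpace X] [BorelSpace X] {L : Seminorm ℝ (Lip X (E n))} {T : Functional X n}
  {μ : Measure X} {H : MultilinearMap ℝ (fun _ : Fin n => Lip X ℝ) (Lp ℝ 1 μ)}

/-- Strict locality: the density vanishes almost everywhere on level sets of the coordinate
functions. -/
theorem IsDensity.ae_eq_zero_of_coord_eq (hL : IsCompatible L) (hT : IsLCurrent L T)
    (hμ : MassBound L T μ) (hH : IsDensity T μ H) (u : Fin n → Lip X ℝ) (j : Fin n) (c : ℝ) :
    ∀ᵐ x ∂μ, (u j).1 x = c → H u x = 0 := by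
  have := hμ.1
  let Z : Set X := {x | (u j).1 x = c}
  have hZ : MeasurableSet Z :=
    (isClosed_eq (lip_continuous (u j)) continuous_const).measurableSet
  let ε : ℕ → ℝ := fun k => 1 / ((k : ℝ) + 1)
  have hε : ∀ k, 0 < ε k := fun k => by positivity
  let g : ℕ → Fin n → Lip ℝ ℝ := fun k i =>
    if i = j then ⟨collapse c (ε k), 1, lipschitzWith_collapse c (hε k).le⟩
    else ⟨id, 1, LipschitzWith.id⟩
  have hg : ∀ k i, LipschitzWith 1 (g k i).1 := fun k i => by
    by_cases hi : i = j
    · simpa [g, hi] using lipschitzWith_collapse c (hε k).le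
    · simpa [g, hi] using LipschitzWith.id
  let v : ℕ → Fin n → Lip X ℝ := fun k i => lipComp (g k i) (u i).1 (u i).2
  have hv : ∀ k, ∀ᵐ x ∂μ, x ∈ Z → H (v k) x = 0 := by
    intro k
    -- The cutoff is 1 on `Z` and supported where `u j` is within `ε k / 2` of `c`, hence inside the
    -- open set on which the collapsed coordinate is constant; the locality axiom applies to every
    -- `f * χ`.
    let χ : LipB X := lipBComp (lipBThickened (half_pos (hε k)) {c}) (u j).1 (u j).2
    have h0 : ∀ f : LipB X, ∫ x, f.1 x * (χ.1 x * H (v k) x) ∂μ = 0 := by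
      intro f
      have h1 : T (lipBMul f χ) (lipOfCoord (v k)) = 0 := by
        refine hT.locality _ _ j ⟨{x | |(u j).1 x - c| < ε k}, ?_, ?_, c, fun x hx => ?_⟩
        · exact isOpen_lt (by have := lip_continuous (u j); fun_prop) continuous_const
        · have hcl : IsClosed {x | |(u j).1 x - c| ≤ ε k / 2} :=
            isClosed_le (by have := lip_continuous (u j); fun_prop) continuous_const
          refine (closure_minimal (fun x hx => ?_) hcl).trans fun x hx =>
            lt_of_le_of_lt hx (half_lt_self (hε k))
          by_contra hx'
          refine hx ?_
          have : χ.1 x = 0 := by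
            have h2 : (u j).1 x ∉ Metric.thickening (ε k / 2) {c} := by
              rw [Metric.thickening_singleton, Metric.mem_ball, Real.dist_eq, not_lt]
              exact (not_le.1 hx').le
            have h3 := thickenedIndicator_zero (half_pos (hε k)) _ h2
            change ((thickenedIndicator (half_pos (hε k)) {c} ((u j).1 x) : ℝ≥0) : ℝ) = 0
            rw [h3, NNReal.coe_zero]
          change f.1 x * χ.1 x = 0
          rw [this, mul_zero]
        · change (g k j).1 ((u j).1 x) = c
          simpa [g] using collapse_eq (le_of_lt hx)
      rw [hH] at h1
      rw [← h1]
      refine integral_congr_ae (.of_forall fun x => ?_)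
      exact (mul_assoc _ _ _).symm
    have h1 := ae_eq_zero_of_forall_lipB (lipB_integrable_mul χ (L1.integrable_coeFn (H (v k)))) h0
    filter_upwards [h1] with x hx hxZ
    have h2 : χ.1 x = 1 := by
      have h3 := thickenedIndicator_one (half_pos (hε k)) {c} (x := (u j).1 x) hxZ
      change ((thickenedIndicator (half_pos (hε k)) {c} ((u j).1 x) : ℝ≥0) : ℝ) = 1
      rw [h3, NNReal.coe_one]
    simpa [h2] using hx
  have h0 : ∀ f : LipB X, ∫ x, f.1 x * Z.indicator (H u) x ∂μ = 0 := by
    intro f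
    -- The collapse is undone by letting `k → ∞`. The test function is cut off to `Z` and no longer
    -- Lipschitz, so the extended form of continuity is needed.
    have h1 := hH.tendsto_integral hT hμ ((lipB_integrable f μ).indicator hZ)
      (p := fun k => lipOfCoord (v k)) (π := lipOfCoord u) (C := (1 : ℝ≥0) * L (lipOfCoord u))
      (fun x => tendsto_lipOfCoord fun i => ?_) (fun k => hL.lipOfCoord_comp_le (hg k) u)
    · have h2 : ∀ k, ∫ x, Z.indicator f.1 x * H (lipCoord (lipOfCoord (v k))) x ∂μ = 0 := by
        intro k
        refine integral_eq_zero_of_ae ((hv k).mono fun x hx => ?_)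
        by_cases hxZ : x ∈ Z
        · have h3 : H (lipCoord (lipOfCoord (v k))) x = 0 := hx hxZ
          simp [h3]
        · simp [hxZ]
      simp only [h2] at h1
      rw [← tendsto_nhds_unique tendsto_const_nhds h1 |>.symm]
      congr 1
      ext x
      by_cases hxZ : x ∈ Z
      · simp only [Set.indicator_of_mem hxZ]; rfl
      · simp [hxZ]
    · change Tendsto (fun k => (g k i).1 ((u i).1 x)) atTop (𝓝 ((u i).1 x))
      by_cases hi : i = j
      · subst hi
        simpa only [g, if_true] using
          tendsto_collapse c ((u i).1 x) tendsto_one_div_add_atTop_nhds_zero_nat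
      · simp [g, hi]
  filter_upwards [ae_eq_zero_of_forall_lipB ((L1.integrable_coeFn (H u)).indicator hZ) h0]
    with x hx hxZ
  have hxZ : x ∈ Z := hxZ
  simpa [hxZ] using hx

/-- Perturb the two equal coordinates in opposite directions by the distance to the grid of mesh
1/(k+1). At every point one of them then lies in the grid, so strict locality on countably many
level sets kills the density. The perturbations tend to `u` with `L` at most doubled, and continuity
concludes. -/
theorem IsDensity.map_eq_zero_of_eq (hL : IsCompatible L) (hT : IsLCurrent L T)
    (hμ : MassBound L T μ) (hH : IsDensity T μ H) (u : Fin n → Lip X ℝ) {i j : Fin n}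
    (hu : u i = u j) (hij : i ≠ j) : H u = 0 := by
  have := hμ.1
  let g : ℕ → Fin n → Lip ℝ ℝ := fun k l =>
    if l = i then ⟨fun t => t + distGrid k t, _, LipschitzWith.id.add (lipschitzWith_distGrid k)⟩
    else if l = j then
      ⟨fun t => t - distGrid k t, _, LipschitzWith.id.sub (lipschitzWith_distGrid k)⟩
    else ⟨id, 1, LipschitzWith.id⟩
  have hg : ∀ k l, LipschitzWith (1 + 1) (g k l).1 := fun k l => by
    by_cases hi : l = i
    · simpa only [g, hi, if_true] using! LipschitzWith.id.add (lipschitzWith_distGrid k)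
    by_cases hj : l = j
    · simpa only [g, hi, if_false, hj, hij.symm, if_true] using!
        LipschitzWith.id.sub (lipschitzWith_distGrid k)
    · simpa only [g, hi, hj, if_false] using LipschitzWith.id.weaken (by simp)
  let v : ℕ → Fin n → Lip X ℝ := fun k l => lipComp (g k l) (u l).1 (u l).2
  have hv : ∀ k, H (v k) =ᵐ[μ] 0 := by
    intro k
    filter_upwards [ae_all_iff.2 fun m : ℤ =>
        hH.ae_eq_zero_of_coord_eq hL hT hμ (v k) i (m / (k + 1)),
      ae_all_iff.2 fun m : ℤ =>
        hH.ae_eq_zero_of_coord_eq hL hT hμ (v k) j (m / (k + 1))] with x h1 h2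
    obtain ⟨m, hm | hm⟩ := exists_add_or_sub_distGrid_eq k ((u i).1 x)
    · refine h1 m ?_
      change (g k i).1 ((u i).1 x) = _
      simpa [g] using hm
    · refine h2 m ?_
      change (g k j).1 ((u j).1 x) = _
      rw [← hu]
      simpa [g, hij.symm] using hm
  refine lp_eq_of_forall_lipB fun f => ?_
  have h1 := hT.continuity f (fun k => lipOfCoord (v k)) (lipOfCoord u)
    (fun x => tendsto_lipOfCoord fun l => ?_) ⟨_, fun k => hL.lipOfCoord_comp_le (hg k) u⟩
  · have h2 : ∀ k, T f (lipOfCoord (v k)) = 0 := fun k => by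
      rw [hH]
      refine integral_eq_zero_of_ae ((hv k).mono fun x hx => ?_)
      have h3 : H (lipCoord (lipOfCoord (v k))) x = 0 := hx
      simp [h3]
    simp only [h2] at h1
    have h3 := tendsto_nhds_unique tendsto_const_nhds h1
    rw [hH] at h3
    refine Eq.trans h3.symm (integral_eq_zero_of_ae ?_).symm
    filter_upwards [Lp.coeFn_zero ℝ 1 μ] with x hx
    rw [hx]
    simp
  · change Tendsto (fun k => (g k l).1 ((u l).1 x)) atTop (𝓝 ((u l).1 x))
    by_cases hi : l = i
    · simpa [g, hi] using (tendsto_distGrid ((u i).1 x)).const_add ((u i).1 x)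
    by_cases hj : l = j
    · simpa [g, hi, hj, hij.symm] using (tendsto_distGrid ((u j).1 x)).const_sub ((u j).1 x)
    · simp [g, hi, hj]

/-- If `u` and `v` agree on a set, then so do `H u` and `H v` up to a null set. -/
theorem IsDensity.ae_eq_of_eqOn (hL : IsCompatible L) (hT : IsLCurrent L T)
    (hμ : MassBound L T μ) (hH : IsDensity T μ H) (u v : Fin n → Lip X ℝ) :
    ∀ᵐ x ∂μ, (∀ j, (u j).1 x = (v j).1 x) → H u x = H v x := by
  classical
  -- In the multilinear expansion of u = v + (u - v), every term but `H v` has a coordinate `u j - v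
  -- j`, which is zero on the set of agreement.
  have h1 : H u = ∑ s : Finset (Fin n), H (s.piecewise v (u - v)) := by
    rw [← H.map_add_univ, add_sub_cancel]
  have h2 : ∀ s : Finset (Fin n), ∀ᵐ x ∂μ, (∀ j, (u j).1 x = (v j).1 x) →
      s ≠ Finset.univ → H (s.piecewise v (u - v)) x = 0 := by
    intro s
    by_cases hs : s = Finset.univ
    · exact .of_forall fun x _ h => absurd hs h
    · obtain ⟨j, hj⟩ : ∃ j, j ∉ s := by
        by_contra! h
        exact hs (Finset.eq_univ_iff_forall.2 h)
      filter_upwards [hH.ae_eq_zero_of_coord_eq hL hT hμ (s.piecewise v (u - v)) j 0] with x hx hu _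
      refine hx ?_
      rw [Finset.piecewise_eq_of_notMem _ _ _ hj]
      exact sub_eq_zero.2 (hu j)
  filter_upwards [ae_all_iff.2 h2, Lp.coeFn_finsetSum Finset.univ
    fun s : Finset (Fin n) => H (s.piecewise v (u - v))] with x hx hsum hu
  rw [h1, hsum, Finset.sum_apply, Finset.sum_eq_single Finset.univ]
  · rw [Finset.piecewise_univ]
  · exact fun s _ hs => hx s hu hs
  · simp

end Locality

/-! ### The chain rule for the density -/

section ChainRule

theorem alternatingMap_eq_det_smul {ι R M N : Type*} [Fintype ι] [DecidableEq ι] [CommRing R]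
    [AddCommGroup M] [Module R M] [AddCommGroup N] [Module R N] (f : M [⋀^ι]→ₗ[R] N)
    (e : Module.Basis ι R M) (v : ι → M) : f v = e.det v • f e := by
  have h : f = (LinearMap.toSpanSingleton R N (f e)).compAlternatingMap e.det := by
    refine Module.Basis.ext_alternating e fun i hi => ?_
    let σ : Equiv.Perm ι := Equiv.ofBijective i (Finite.injective_iff_bijective.1 hi)
    change f (e ∘ σ) = e.det (e ∘ σ) • f e
    rw [AlternatingMap.map_perm, AlternatingMap.map_perm, e.det_self]
    simp [Units.smul_def, Int.cast_smul_eq_zsmul]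
  conv_lhs => rw [h]
  rfl

theorem exists_lipschitzWith_lipOfCoord (n : ℕ) : ∃ D : ℝ≥0, ∀ {X : Type*} [MetricSpace X]
    (w : Fin n → Lip X ℝ), (∀ j, LipschitzWith 1 (w j).1) → LipschitzWith D (lipOfCoord w).1 := by
  refine ⟨_, fun w hw => (PiLp.lipschitzWith_toLp 2 fun _ : Fin n => ℝ).comp
    (LipschitzWith.of_dist_le_mul (K := 1) fun x y => (dist_pi_le_iff (by positivity)).2 fun j =>
      (hw j).dist_le_mul x y)⟩

variable {X : Type*} [MetricSpace X] {n : ℕ}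

/-- The composition of Lipschitz functions on `ℝⁿ` with a Lipschitz map `ψ : X → ℝⁿ`. -/
noncomputable def lipPull (ψ : Lip X (E n)) (v : Fin n → Lip (E n) ℝ) : Fin n → Lip X ℝ :=
  fun j => lipComp (v j) ψ.1 ψ.2

/-- A continuous linear map as a Lipschitz map. -/
noncomputable def lipOfCLM (A : E n →L[ℝ] E n) : Lip (E n) (E n) := ⟨A, _, A.lipschitz⟩

variable [MeasurableSpace X] [BorelSpace X] {L : Seminorm ℝ (Lip X (E n))} {T : Functional X n}
  {μ : Measure X} {H : MultilinearMap ℝ (fun _ : Fin n => Lip X ℝ) (Lp ℝ 1 μ)}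

/-- Scale each coordinate to be 1-Lipschitz, apply compatibility, and recover the factors by
multilinearity. The product form makes a term small as soon as a single coordinate has a small
Lipschitz constant. -/
theorem IsDensity.exists_ae_abs_le_prod (hL : IsCompatible L)
    (hμ : MassBound L T μ) (hH : IsDensity T μ H) (ψ : Lip X (E n)) :
    ∃ B : ℝ, 0 ≤ B ∧ ∀ (v : Fin n → Lip (E n) ℝ) (c : Fin n → ℝ≥0), (∀ j, 0 < c j) →
      (∀ j, LipschitzWith (c j) (v j).1) →
      ∀ᵐ x ∂μ, |H (lipPull ψ v) x| ≤ B * ∏ j, (c j : ℝ) := by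
  obtain ⟨D, hD⟩ := exists_lipschitzWith_lipOfCoord n
  refine ⟨(D * L ψ) ^ n, pow_nonneg (mul_nonneg D.2 (apply_nonneg _ _)) _,
    fun v c hc hv => ?_⟩
  have hw : ∀ j, LipschitzWith 1 (((c j : ℝ)⁻¹ • v j : Lip (E n) ℝ)).1 := fun j => by
    refine LipschitzWith.of_dist_le_mul fun x y => ?_
    have hcj : (0 : ℝ) < c j := hc j
    have h := (hv j).dist_le_mul x y
    change dist ((c j : ℝ)⁻¹ * (v j).1 x) ((c j : ℝ)⁻¹ * (v j).1 y) ≤ _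
    rw [Real.dist_eq] at h ⊢
    rw [← mul_sub, abs_mul, abs_of_pos (inv_pos.2 hcj), NNReal.coe_one, one_mul,
      inv_mul_le_iff₀ hcj]
    exact h
  set w : Fin n → Lip (E n) ℝ := fun j => (c j : ℝ)⁻¹ • v j with hwdef
  have h1 : H (lipPull ψ v) = (∏ j, (c j : ℝ)) • H (lipPull ψ w) := by
    rw [← H.map_smul_univ]
    congr 1
    ext j : 1
    refine Subtype.ext (funext fun x => ?_)
    have hcj : (c j : ℝ) ≠ 0 := (NNReal.coe_pos.2 (hc j)).ne'
    change (v j).1 (ψ.1 x) = (c j : ℝ) * ((c j : ℝ)⁻¹ * (v j).1 (ψ.1 x))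
    field_simp
  have h2 : L (lipOfCoord (lipPull ψ w)) ≤ D * L ψ := hL (lipOfCoord w) D (hD w hw) ψ
  have h3 : 0 ≤ ∏ j, (c j : ℝ) := Finset.prod_nonneg fun j _ => (c j).2
  filter_upwards [hH.ae_abs_le hμ (lipPull ψ w),
    Lp.coeFn_smul (∏ j, (c j : ℝ)) (H (lipPull ψ w))] with x hx1 hx2
  rw [h1, hx2, Pi.smul_apply, smul_eq_mul, abs_mul, abs_of_nonneg h3, mul_comm]
  exact mul_le_mul_of_nonneg_right
    (hx1.trans (pow_le_pow_left₀ (apply_nonneg _ _) h2 n)) h3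

/-- The density as an alternating map. -/
def IsDensity.alternatingMap (hL : IsCompatible L) (hT : IsLCurrent L T)
    (hμ : MassBound L T μ) (hH : IsDensity T μ H) : Lip X ℝ [⋀^Fin n]→ₗ[ℝ] Lp ℝ 1 μ where
  __ := H
  map_eq_zero_of_eq' u _ _ huv hij := hH.map_eq_zero_of_eq hL hT hμ u huv hij

/-- The coordinates of A ∘ ψ are the linear combinations of those of ψ given by the rows of the
matrix of `A`, and an alternating map in n variables on ℝⁿ is a multiple of the determinant. -/
theorem IsDensity.map_lipPull_clm (hL : IsCompatible L) (hT : IsLCurrent L T)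
    (hμ : MassBound L T μ) (hH : IsDensity T μ H) (ψ : Lip X (E n)) (A : E n →L[ℝ] E n) :
    H (lipPull ψ (lipCoord (lipOfCLM A))) = A.det • H (lipCoord ψ) := by
  let Φ : (Fin n → ℝ) →ₗ[ℝ] Lip X ℝ := Fintype.linearCombination ℝ (lipCoord ψ)
  let G := (hH.alternatingMap hL hT hμ).compLinearMap Φ
  let b := (EuclideanSpace.basisFun (Fin n) ℝ).toBasis
  let M := LinearMap.toMatrix b b (A : E n →ₗ[ℝ] E n)
  have h1 := alternatingMap_eq_det_smul G (Pi.basisFun ℝ (Fin n)) M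
  have h2 : (Pi.basisFun ℝ (Fin n)).det M = A.det := by
    rw [Pi.basisFun_det]
    exact LinearMap.det_toMatrix b _
  have h3 : G (Pi.basisFun ℝ (Fin n)) = H (lipCoord ψ) := by
    change H (fun j => Φ (Pi.basisFun ℝ (Fin n) j)) = _
    congr 1
    ext j : 1
    simp [Φ, Fintype.linearCombination_apply_single]
  have h4 : G M = H (lipPull ψ (lipCoord (lipOfCLM A))) := by
    change H (fun j => Φ (M j)) = _
    congr 1
    ext j : 1
    refine Subtype.ext (funext fun x => ?_)
    have h5 := congrFun (LinearMap.toMatrix_mulVec_repr b b (A : E n →ₗ[ℝ] E n) (ψ.1 x)) j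
    have h6 : (Φ (M j)).1 x = ∑ i, M j i * ψ.1 x i := by
      simp only [Φ, Fintype.linearCombination_apply]
      rw [Submodule.coe_sum, Finset.sum_apply]
      rfl
    rw [h6]
    exact h5
  rw [← h4, h1, h2, h3]

/-- The chain rule: if the image of `μ` under a Lipschitz map `ψ` is absolutely continuous, then
`H(p ∘ ψ) = det(Dp ∘ ψ) H(ψ)`. -/
theorem IsDensity.ae_eq_det_fderiv_mul (hL : IsCompatible L) (hT : IsLCurrent L T)
    (hμ : MassBound L T μ) (hH : IsDensity T μ H) (ψ : Lip X (E n)) {C : Set X}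
    (hψ : (μ.restrict C).map ψ.1 ≪ volume) (p : Lip (E n) (E n)) :
    ∀ᵐ x ∂μ.restrict C,
      H (lipPull ψ (lipCoord p)) x = (fderiv ℝ p.1 (ψ.1 x)).det * H (lipCoord ψ) x := by
  classical
  obtain ⟨B, hB, hBd⟩ := hH.exists_ae_abs_le_prod hL hμ ψ
  obtain ⟨P, hP⟩ := p.2
  set B0 := L ψ ^ n with hB0
  -- The first summand pays for the mixed terms, one per subset of coordinates, the second for
  -- replacing det(Dp) by the determinant of the linear approximation. Using `P + 1` keeps the
  -- constants positive and at least 1.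
  set Q := (Fintype.card (Finset (Fin n)) : ℝ) * (B * (P + 1) ^ n) + B0 with hQ
  have hψm : AEMeasurable ψ.1 (μ.restrict C) := (lip_continuous ψ).measurable.aemeasurable
  let D : Set (E n) := {y | DifferentiableAt ℝ p.1 y}
  have hD : MeasurableSet D := measurableSet_of_differentiableAt ℝ p.1
  have hDae : ∀ᵐ x ∂μ.restrict C, ψ.1 x ∈ D :=
    ae_of_ae_map hψm (hψ.ae_le hP.ae_differentiableAt)
  have main : ∀ ε : ℝ≥0, 0 < ε → ε ≤ 1 → ∀ᵐ x ∂μ.restrict C,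
      |H (lipPull ψ (lipCoord p)) x - (fderiv ℝ p.1 (ψ.1 x)).det * H (lipCoord ψ) x| ≤ ε * Q := by
    intro ε hε hε1
    have hr : ∀ A : E n →L[ℝ] E n, ∃ r : ℝ≥0, r ≠ 0 ∧ r ≤ ε ∧
        ∀ A' : E n →L[ℝ] E n, ‖A' - A‖₊ ≤ r → |A'.det - A.det| ≤ ε := by
      intro A
      obtain ⟨δ, hδ, h⟩ := Metric.continuousAt_iff.1
        (ContinuousLinearMap.continuous_det (𝕜 := ℝ) (E := E n)).continuousAt ε hε
      refine ⟨min ε (⟨δ, hδ.le⟩ / 2), ?_, min_le_left _ _, fun A' hA' => (h (x := A') ?_).le⟩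
      · exact (lt_min hε (half_pos (show (0 : ℝ≥0) < ⟨δ, hδ.le⟩ from hδ))).ne'
      · rw [dist_eq_norm]
        have h1 : ‖A' - A‖ ≤ δ / 2 := hA'.trans (min_le_right _ _)
        linarith
    choose r hr0 hrε hrdet using hr
    -- On each of countably many pieces, p is linear up to an error of Lipschitz constant at most
    -- `ε`. The errors extend to functions `q j` on ℝⁿ with the same constant, and p may be replaced
    -- by A + q on the piece by strict locality.
    obtain ⟨t, A, -, htm, hcov, hap, hA⟩ :=
      exists_partition_approximatesLinearOn_of_hasFDerivWithinAt p.1 D (fderiv ℝ p.1)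
        (fun x hx => hx.hasFDerivAt.hasFDerivWithinAt) r hr0
    have hm : ∀ m, ∀ᵐ x ∂μ.restrict C, ψ.1 x ∈ D ∩ t m →
        |H (lipPull ψ (lipCoord p)) x - (fderiv ℝ p.1 (ψ.1 x)).det * H (lipCoord ψ) x|
          ≤ ε * Q := by
      intro m
      by_cases hDn : D.Nonempty
      swap
      · exact .of_forall fun x hx => absurd ⟨_, hx.1⟩ hDn
      have hAP : ‖A m‖ ≤ P := by
        obtain ⟨y, -, hy⟩ := hA hDn m
        rw [hy]
        exact norm_fderiv_le_of_lipschitz ℝ hP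
      have hq : ∀ j, ∃ q : Lip (E n) ℝ, LipschitzWith ε q.1 ∧
          ∀ y ∈ D ∩ t m, p.1 y j - A m y j = q.1 y := by
        intro j
        have h1 : LipschitzOnWith ε (fun y => p.1 y j - A m y j) (D ∩ t m) := by
          refine LipschitzOnWith.of_dist_le_mul fun x hx y hy => ?_
          have h2 := (hap m).lipschitzOnWith.dist_le_mul x hx y hy
          have h3 := PiLp.norm_apply_le ((p.1 - ⇑(A m)) x - (p.1 - ⇑(A m)) y) j
          rw [dist_eq_norm] at h2 ⊢
          refine (h3.trans h2).trans ?_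
          gcongr
          exact hrε _
        obtain ⟨q, hq, hq'⟩ := h1.extend_real
        exact ⟨⟨q, ε, hq⟩, hq, hq'⟩
      choose q hqε hq using hq
      set a := lipCoord (lipOfCLM (A m)) with ha
      have haL : ∀ j, LipschitzWith (P + 1) (a j).1 := fun j => by
        refine LipschitzWith.of_dist_le_mul fun x y => ?_
        have h2 := (A m).lipschitz.dist_le_mul x y
        have h3 := PiLp.norm_apply_le (A m x - A m y) j
        rw [dist_eq_norm] at h2 ⊢
        refine (h3.trans h2).trans ?_
        gcongr
        refine le_trans ?_ (le_add_of_nonneg_right zero_le_one)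
        exact hAP
      have hsum : H (lipPull ψ (a + q)) = ∑ s : Finset (Fin n), H (lipPull ψ (s.piecewise a q)) := by
        have h1 : lipPull ψ (a + q) = lipPull ψ a + lipPull ψ q := rfl
        rw [h1, H.map_add_univ]
        refine Finset.sum_congr rfl fun s _ => ?_
        congr 1
        ext j : 1
        by_cases hj : j ∈ s <;> simp [lipPull, hj]
      have hterm : ∀ s : Finset (Fin n), ∀ᵐ x ∂μ, s ≠ Finset.univ →
          |H (lipPull ψ (s.piecewise a q)) x| ≤ ε * (B * (P + 1) ^ n) := by
        intro s
        by_cases hs : s = Finset.univ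
        · exact .of_forall fun x h => absurd hs h
        obtain ⟨j, hj⟩ : ∃ j, j ∉ s := by
          by_contra! h
          exact hs (Finset.eq_univ_iff_forall.2 h)
        let c : Fin n → ℝ≥0 := fun i => if i ∈ s then P + 1 else ε
        have hc : ∀ i, 0 < c i := fun i => by
          by_cases hi : i ∈ s <;> simp only [c, hi, if_true, if_false]
          · positivity
          · exact hε
        have hc1 : ∀ i, c i ≤ P + 1 := fun i => by
          by_cases hi : i ∈ s <;> simp only [c, hi, if_true, if_false]
          · exact le_rfl
          · exact hε1.trans (le_add_of_nonneg_left zero_le)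
        have hcL : ∀ i, LipschitzWith (c i) (s.piecewise a q i).1 := fun i => by
          by_cases hi : i ∈ s
          · simpa [c, hi] using haL i
          · simpa [c, hi] using hqε i
        have hprod : ∏ i, c i ≤ ε * (P + 1) ^ n := by
          rw [← Finset.mul_prod_erase Finset.univ c (Finset.mem_univ j)]
          have h1 : c j = ε := by simp [c, hj]
          rw [h1]
          gcongr
          refine (Finset.prod_le_pow_card _ _ _ fun i _ => hc1 i).trans ?_
          refine pow_le_pow_right₀ (le_add_of_nonneg_left zero_le) ?_
          refine (Finset.card_le_univ _).trans ?_
          simp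
        filter_upwards [hBd _ c hc hcL] with x hx _
        refine hx.trans ?_
        have h2 : ∏ i, (c i : ℝ) ≤ ε * (P + 1) ^ n := by exact_mod_cast hprod
        calc B * ∏ i, (c i : ℝ) ≤ B * (ε * (P + 1) ^ n) := mul_le_mul_of_nonneg_left h2 hB
          _ = _ := by ring
      have hdet : ∀ᵐ x ∂μ.restrict C, ψ.1 x ∈ D ∩ t m →
          |(fderiv ℝ p.1 (ψ.1 x)).det - (A m).det| ≤ ε := by
        -- The derivative is close to `A m` only at Lebesgue-almost every point of the piece;
        -- absolute continuity of the image measure turns this into a statement for almost every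
        -- `x`.
        have h1 := (hap m).norm_fderiv_sub_le volume (hD.inter (htm m)) (fderiv ℝ p.1)
          fun x hx => hx.1.hasFDerivAt.hasFDerivWithinAt
        rw [ae_restrict_iff' (hD.inter (htm m))] at h1
        filter_upwards [ae_of_ae_map hψm (hψ.ae_le h1)] with x hx hxD
        exact hrdet _ _ (hx hxD)
      filter_upwards [hdet, ae_restrict_of_ae (ae_all_iff.2 hterm),
        ae_restrict_of_ae (hH.ae_eq_of_eqOn hL hT hμ (lipPull ψ (lipCoord p)) (lipPull ψ (a + q))),
        ae_restrict_of_ae (hH.ae_abs_le hμ (lipCoord ψ)),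
        ae_restrict_of_ae (Lp.coeFn_smul (A m).det (H (lipCoord ψ))),
        ae_restrict_of_ae (Lp.coeFn_finsetSum Finset.univ
          fun s : Finset (Fin n) => H (lipPull ψ (s.piecewise a q)))]
        with x hx1 hx2 hx3 hx4 hx5 hx6 hxD
      have e1 : H (lipPull ψ (lipCoord p)) x = H (lipPull ψ (a + q)) x := by
        refine hx3 fun j => ?_
        change p.1 (ψ.1 x) j = A m (ψ.1 x) j + (q j).1 (ψ.1 x)
        rw [← hq j _ hxD]
        ring
      have e2 : H (lipPull ψ (a + q)) x = (A m).det * H (lipCoord ψ) x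
          + ∑ s ∈ Finset.univ.erase Finset.univ, H (lipPull ψ (s.piecewise a q)) x := by
        rw [hsum, hx6, Finset.sum_apply,
          ← Finset.add_sum_erase Finset.univ _ (Finset.mem_univ Finset.univ),
          Finset.piecewise_univ, ha, hH.map_lipPull_clm hL hT hμ, hx5]
        rfl
      have e3 : |∑ s ∈ Finset.univ.erase Finset.univ, H (lipPull ψ (s.piecewise a q)) x|
          ≤ (Fintype.card (Finset (Fin n)) : ℝ) * (ε * (B * (P + 1) ^ n)) := by
        refine (Finset.abs_sum_le_sum_abs _ _).trans
          ((Finset.sum_le_card_nsmul _ _ _ fun s hs => hx2 s (Finset.ne_of_mem_erase hs)).trans ?_)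
        rw [nsmul_eq_mul]
        gcongr
        exact Finset.card_le_univ _
      have e4 : |((fderiv ℝ p.1 (ψ.1 x)).det - (A m).det) * H (lipCoord ψ) x| ≤ ε * B0 := by
        rw [abs_mul]
        exact mul_le_mul (hx1 hxD) hx4 (abs_nonneg _) ε.2
      rw [e1, e2]
      rw [abs_le] at e3 e4 ⊢
      constructor <;> rw [hQ] <;> linarith [e3.1, e3.2, e4.1, e4.2]
    filter_upwards [ae_all_iff.2 hm, hDae] with x hx hxD
    obtain ⟨m, hxm⟩ := Set.mem_iUnion.1 (hcov hxD)
    exact hx m ⟨hxD, hxm⟩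
  filter_upwards [ae_all_iff.2 fun k : ℕ => main (1 / ((k : ℝ≥0) + 1)) (by positivity)
    (div_le_one_of_le₀ (le_add_of_nonneg_left zero_le) zero_le)] with x hx
  have h1 : Tendsto (fun k : ℕ => ((1 / ((k : ℝ≥0) + 1) : ℝ≥0) : ℝ) * Q) atTop (𝓝 0) := by
    simpa using (tendsto_one_div_add_atTop_nhds_zero_nat (𝕜 := ℝ)).mul_const Q
  exact sub_eq_zero.1 (abs_nonpos_iff.1 (ge_of_tendsto' h1 hx))

end ChainRule

/-! ### Restriction to the image of a chart -/

section Parametrization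

open scoped ENNReal

/-- `θ` is the Radon–Nikodym density of the image under `ψ` of the signed measure h ρ, obtained from
the positive and negative parts of `h`. -/
theorem exists_integrable_of_map_absolutelyContinuous {X Y : Type*} [MeasurableSpace X]
    [MeasurableSpace Y] {ρ : Measure X} {ν : Measure Y} [SigmaFinite ν] {ψ : X → Y}
    (hψ : Measurable ψ) (hac : ρ.map ψ ≪ ν) {h : X → ℝ} (hh : Integrable h ρ) :
    ∃ θ : Y → ℝ, Integrable θ ν ∧ ∀ G : Y → ℝ, Measurable G → (∃ M, ∀ y, |G y| ≤ M) →
      ∫ y, θ y * G y ∂ν = ∫ x, G (ψ x) * h x ∂ρ := by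
  have aux : ∀ d : X → ℝ, Integrable d ρ → ∃ θ : Y → ℝ, Integrable θ ν ∧
      ∀ G : Y → ℝ, Measurable G →
        ∫ y, θ y * G y ∂ν = ∫ x, G (ψ x) * max (d x) 0 ∂ρ := by
    intro d hd
    let κ := (ρ.withDensity fun x => ENNReal.ofReal (d x)).map ψ
    have : IsFiniteMeasure (ρ.withDensity fun x => ENNReal.ofReal (d x)) :=
      isFiniteMeasure_withDensity_ofReal hd.2
    have hκ : κ ≪ ν := ((withDensity_absolutelyContinuous _ _).map hψ).trans hac
    refine ⟨fun y => (κ.rnDeriv ν y).toReal, Measure.integrable_toReal_rnDeriv, fun G hG => ?_⟩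
    rw [integral_toReal_rnDeriv_mul hκ, integral_map hψ.aemeasurable hG.aestronglyMeasurable,
      integral_withDensity_eq_integral_toReal_smul₀ hd.1.aemeasurable.ennreal_ofReal
        (.of_forall fun x => ENNReal.ofReal_lt_top)]
    refine integral_congr_ae (.of_forall fun x => ?_)
    simp only [ENNReal.toReal_ofReal', smul_eq_mul, mul_comm]
  obtain ⟨θ₁, hθ₁, h₁⟩ := aux h hh
  obtain ⟨θ₂, hθ₂, h₂⟩ := aux (-h) hh.neg
  refine ⟨θ₁ - θ₂, hθ₁.sub hθ₂, fun G hG ⟨M, hM⟩ => ?_⟩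
  have hb : ∀ᵐ y ∂ν, ‖G y‖ ≤ M := .of_forall hM
  have hb' : ∀ᵐ x ∂ρ, ‖G (ψ x)‖ ≤ M := .of_forall fun x => hM _
  have hm : AEStronglyMeasurable (fun x => G (ψ x)) ρ := (hG.comp hψ).aestronglyMeasurable
  simp only [Pi.sub_apply, sub_mul]
  rw [integral_sub (hθ₁.mul_bdd hG.aestronglyMeasurable hb)
    (hθ₂.mul_bdd hG.aestronglyMeasurable hb), h₁ G hG, h₂ G hG,
    ← integral_sub (hh.pos_part.bdd_mul hm hb') (hh.neg.pos_part.bdd_mul hm hb')]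
  refine integral_congr_ae (.of_forall fun x => ?_)
  simp only [Pi.neg_apply]
  rw [← mul_sub, max_zero_sub_eq_self]

theorem exists_lip_leftInverse {X : Type*} [MetricSpace X] {n : ℕ} {K : Set (E n)} {φ : K → X}
    (hφ : ∃ C : ℝ≥0, AntilipschitzWith C φ) : ∃ ψ : Lip X (E n), ∀ k, ψ.1 (φ k) = k.1 := by
  classical
  obtain ⟨C, hC⟩ := hφ
  let g : X → E n := fun x => if h : ∃ k, φ k = x then h.choose.1 else 0
  have hg : ∀ k, g (φ k) = k.1 := fun k => by
    have h : ∃ k', φ k' = φ k := ⟨k, rfl⟩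
    simp only [g, dif_pos h]
    rw [hC.injective h.choose_spec]
  have hL : LipschitzOnWith C g (Set.range φ) := by
    refine LipschitzOnWith.of_dist_le_mul ?_
    rintro _ ⟨k, rfl⟩ _ ⟨l, rfl⟩
    rw [hg, hg]
    exact hC.le_mul_dist k l
  obtain ⟨ψ, hψ, hψg⟩ := hL.extend_finite_dimension
  exact ⟨⟨ψ, _, hψ⟩, fun k => (hψg (Set.mem_range_self k)).symm.trans (hg k)⟩

theorem hausdorffMeasure_image_eq_zero {X : Type*} [MetricSpace X] [MeasurableSpace X]
    [BorelSpace X] {n : ℕ} {K : Set (E n)} {φ : K → X} (hφ : ∃ C : ℝ≥0, LipschitzWith C φ)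
    {N : Set (E n)} (hN : volume N = 0) :
    (Measure.hausdorffMeasure (n : ℝ) : Measure X) (φ '' (Subtype.val ⁻¹' N)) = 0 := by
  obtain ⟨C, hC⟩ := hφ
  have h1 := isAddHaarMeasure_hausdorffMeasure (E := E n)
  rw [finrank_euclideanSpace_fin] at h1
  have h2 : (Measure.hausdorffMeasure (n : ℝ) : Measure (E n)) N = 0 :=
    Measure.absolutelyContinuous_isAddHaarMeasure _ volume hN
  have h3 : (Measure.hausdorffMeasure (n : ℝ) : Measure K) (Subtype.val ⁻¹' N) = 0 := by
    rw [← isometry_subtype_coe.hausdorffMeasure_image (.inl n.cast_nonneg)]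
    exact measure_mono_null (Set.image_preimage_subset _ _) h2
  refine le_antisymm ((hC.hausdorffMeasure_image_le n.cast_nonneg _).trans ?_) zero_le
  rw [h3, mul_zero]

variable {X : Type*} [MetricSpace X] [MeasurableSpace X] [BorelSpace X] {n : ℕ}
  {L : Seminorm ℝ (Lip X (E n))} {T : Functional X n}
  {μ : Measure X} {H : MultilinearMap ℝ (fun _ : Fin n => Lip X ℝ) (Lp ℝ 1 μ)}

/-- Within the image of φ, the preimage of a Lebesgue-null set N under ψ is φ(K ∩ N), which is
ℋⁿ-null because φ is Lipschitz. -/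
theorem map_restrict_range_absolutelyContinuous {K : Set (E n)} {φ : K → X} (hK : IsCompact K)
    (hφ : ∃ C : ℝ≥0, LipschitzWith C φ) {ψ : Lip X (E n)} (hψ : ∀ k, ψ.1 (φ k) = k.1)
    (hvan : ∀ B : Set X, MeasurableSet B →
      (Measure.hausdorffMeasure (n : ℝ) : Measure X) B = 0 → μ B = 0) :
    (μ.restrict (Set.range φ)).map ψ.1 ≪ volume := by
  have : CompactSpace K := isCompact_iff_compactSpace.1 hK
  have hφc : Continuous φ := let ⟨_, hC⟩ := hφ; hC.continuous
  have hψm : Measurable ψ.1 := (lip_continuous ψ).measurable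
  refine Measure.AbsolutelyContinuous.mk fun N hNm hN => ?_
  rw [Measure.map_apply hψm hNm, Measure.restrict_apply (hψm hNm)]
  refine hvan _ ((hψm hNm).inter (isCompact_range hφc).measurableSet)
    (measure_mono_null ?_ (hausdorffMeasure_image_eq_zero hφ hN))
  rintro _ ⟨hx, k, rfl⟩
  refine ⟨k, ?_, rfl⟩
  have h : ψ.1 (φ k) ∈ N := hx
  rwa [hψ k] at h

/-- The restriction of a current to the image of a bi-Lipschitz embedding is the push-forward of
an integrable function. -/
theorem IsDensity.exists_pushforward_eq (hL : IsCompatible L) (hT : IsLCurrent L T)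
    (hμ : MassBound L T μ) (hH : IsDensity T μ H)
    (hvan : ∀ B : Set X, MeasurableSet B →
      (Measure.hausdorffMeasure (n : ℝ) : Measure X) B = 0 → μ B = 0)
    {K : Set (E n)} {φ : K → X} (hK : IsCompact K) (hφ : ∃ C : ℝ≥0, LipschitzWith C φ)
    (hφ' : ∃ C : ℝ≥0, AntilipschitzWith C φ) :
    ∃ θ : E n → ℝ, Integrable θ ∧ tsupport θ ⊆ K ∧ ∀ f π,
      pushforward φ hφ (euclideanCurrentOn θ K) f π
        = ∫ x in Set.range φ, f.1 x * H (lipCoord π) x ∂μ := by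
  have := hμ.1
  have : CompactSpace K := isCompact_iff_compactSpace.1 hK
  have hφc : Continuous φ := let ⟨_, hC⟩ := hφ; hC.continuous
  have hC : MeasurableSet (Set.range φ) := (isCompact_range hφc).measurableSet
  obtain ⟨ψ, hψ⟩ := exists_lip_leftInverse hφ'
  have hψm : Measurable ψ.1 := (lip_continuous ψ).measurable
  have hac := map_restrict_range_absolutelyContinuous hK hφ hψ hvan
  obtain ⟨θ, hθ, hθG⟩ := exists_integrable_of_map_absolutelyContinuous hψm hac
    (L1.integrable_coeFn (H (lipCoord ψ))).restrict
  -- Cutting `θ` off outside `K` gives the support condition and costs nothing, since the functional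
  -- already contains the indicator of `K`.
  refine ⟨K.indicator θ, hθ.indicator hK.measurableSet,
    closure_minimal Set.support_indicator_subset hK.isClosed, fun f π => ?_⟩
  set f' := lipExtend (lipBToLip (lipBComp f φ hφ)) with hf'
  set p := lipExtend (lipComp π φ hφ) with hp
  have hf'K : ∀ k : K, f'.1 k = f.1 (φ k) :=
    (exists_lipschitz_extension (lipBToLip (lipBComp f φ hφ))).choose_spec
  have hpK : ∀ k : K, p.1 k = π.1 (φ k) :=
    (exists_lipschitz_extension (lipComp π φ hφ)).choose_spec
  let G : E n → ℝ := fun y => K.indicator f'.1 y * (fderiv ℝ p.1 y).det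
  have hG : Measurable G :=
    ((lip_continuous f').measurable.indicator hK.measurableSet).mul
      (ContinuousLinearMap.continuous_det.measurable.comp (measurable_fderiv ℝ p.1))
  have hGb : ∃ M, ∀ y, |G y| ≤ M := by
    obtain ⟨-, M, hM⟩ := f.2
    obtain ⟨P, hP⟩ := p.2
    obtain ⟨D, hD⟩ := ((isCompact_closedBall (0 : E n →L[ℝ] E n) P).image
      ContinuousLinearMap.continuous_det).isBounded.exists_norm_le
    have hdet : ∀ y, |(fderiv ℝ p.1 y).det| ≤ D := fun y =>
      hD _ ⟨_, by simpa using norm_fderiv_le_of_lipschitz ℝ hP, rfl⟩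
    have hD0 : 0 ≤ D := (abs_nonneg _).trans (hdet 0)
    refine ⟨max M 0 * D, fun y => ?_⟩
    rw [abs_mul]
    refine mul_le_mul ?_ (hdet y) (abs_nonneg _) (le_max_right _ _)
    by_cases hy : y ∈ K
    · rw [Set.indicator_of_mem hy, hf'K ⟨y, hy⟩]
      exact (hM _).trans (le_max_left _ _)
    · simp [hy]
  have h1 : pushforward φ hφ (euclideanCurrentOn (K.indicator θ) K) f π = ∫ y, θ y * G y := by
    refine integral_congr_ae (.of_forall fun y => ?_)
    change K.indicator θ y * K.indicator f'.1 y * (fderiv ℝ p.1 y).det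
      = θ y * (K.indicator f'.1 y * (fderiv ℝ p.1 y).det)
    by_cases hy : y ∈ K
    · simp only [Set.indicator_of_mem hy, mul_assoc]
    · simp [hy]
  rw [h1, hθG G hG hGb]
  refine integral_congr_ae ?_
  -- On the image of φ, π agrees with p ∘ ψ, so strict locality and the chain rule give H(π) = H(p ∘
  -- ψ) = det(Dp ∘ ψ) H(ψ) there.
  filter_upwards [ae_restrict_mem hC, hH.ae_eq_det_fderiv_mul hL hT hμ ψ hac p,
    ae_restrict_of_ae (hH.ae_eq_of_eqOn hL hT hμ (lipCoord π) (lipPull ψ (lipCoord p)))]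
    with x hx h2 h3
  obtain ⟨k, rfl⟩ := hx
  rw [h3 fun j => ?_, h2]
  · simp only [G]
    rw [hψ k, Set.indicator_of_mem k.2, hf'K k, mul_assoc]
  · change π.1 (φ k) j = p.1 (ψ.1 (φ k)) j
    rw [hψ k, hpK k]

theorem IsDensity.abs_setIntegral_le (hμ : MassBound L T μ) (hH : IsDensity T μ H) (C : Set X)
    (f : LipB X) (π : Lip X (E n)) :
    |∫ x in C, f.1 x * H (lipCoord π) x ∂μ| ≤ L π ^ n * ∫ x in C, |f.1 x| ∂μ := by
  have := hμ.1
  rw [← integral_const_mul]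
  refine abs_integral_le_integral_abs.trans (integral_mono_ae
    (lipB_integrable_mul f (L1.integrable_coeFn _)).restrict.abs
    ((lipB_integrable f _).abs.const_mul _) ?_)
  filter_upwards [ae_restrict_of_ae (hH.ae_abs_le hμ (lipCoord π))] with x hx
  rw [abs_mul, mul_comm]
  exact mul_le_mul_of_nonneg_right hx (abs_nonneg _)

/-- The restriction of a current to a Borel set is a current. -/
theorem IsDensity.isLCurrent_setIntegral (hL : IsCompatible L) (hT : IsLCurrent L T)
    (hμ : MassBound L T μ) (hH : IsDensity T μ H) {C : Set X} (hC : MeasurableSet C) :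
    IsLCurrent L fun f π => ∫ x in C, f.1 x * H (lipCoord π) x ∂μ := by
  have := hμ.1
  have hi : ∀ (f : LipB X) (w : Lp ℝ 1 μ), Integrable (fun x => f.1 x * w x) (μ.restrict C) :=
    fun f w => (lipB_integrable_mul f (L1.integrable_coeFn w)).restrict
  refine ⟨⟨fun π => ⟨fun f g => ?_, fun c f => ?_⟩, fun f => ?_⟩, fun f p π hp ⟨D, hD⟩ => ?_,
    fun f π j ⟨U, _, hfU, c, hc⟩ => ?_, μ.restrict C, inferInstance,
    hH.abs_setIntegral_le hμ C⟩
  · rw [← integral_add (hi f _) (hi g _)]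
    exact integral_congr_ae (.of_forall fun x => add_mul _ _ _)
  · rw [smul_eq_mul, ← integral_const_mul]
    exact integral_congr_ae (.of_forall fun x => mul_assoc _ _ _)
  · let I : Lp ℝ 1 μ →ₗ[ℝ] ℝ :=
      { toFun := fun w => ∫ x in C, f.1 x * w x ∂μ
        map_add' := fun v w => by
          rw [← integral_add (hi f v) (hi f w)]
          refine integral_congr_ae (ae_restrict_of_ae ((Lp.coeFn_add v w).mono fun x hx => ?_))
          simp only [hx, Pi.add_apply, mul_add]
        map_smul' := fun c w => by
          rw [RingHom.id_apply, smul_eq_mul, ← integral_const_mul]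
          refine integral_congr_ae (ae_restrict_of_ae ((Lp.coeFn_smul c w).mono fun x hx => ?_))
          simp only [hx, Pi.smul_apply, smul_eq_mul, mul_left_comm] }
    exact ⟨I.compMultilinearMap H, fun π => rfl⟩
  · have h1 := hH.tendsto_integral hT hμ ((lipB_integrable f μ).indicator hC) hp hD
    have h2 : ∀ q : Lip X (E n), ∫ x in C, f.1 x * H (lipCoord q) x ∂μ
        = ∫ x, C.indicator f.1 x * H (lipCoord q) x ∂μ := fun q => by
      rw [← integral_indicator hC]
      refine integral_congr_ae (.of_forall fun x => ?_)
      by_cases hx : x ∈ C <;> simp [hx]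
    simpa only [h2] using h1
  · refine integral_eq_zero_of_ae (ae_restrict_of_ae ?_)
    filter_upwards [hH.ae_eq_zero_of_coord_eq hL hT hμ (lipCoord π) j c] with x hx
    by_cases hxU : x ∈ U
    · simp [hx (hc x hxU)]
    · simp [image_eq_zero_of_notMem_tsupport fun h => hxU (hfU h)]

/-- The mass measure of the restriction of a current to a Borel set is the restriction of the mass
measure. -/
theorem massMeasure_setIntegral {H : MultilinearMap ℝ (fun _ : Fin n => Lip X ℝ)
      (Lp ℝ 1 (massMeasure L T))} (hμ : MassBound L T (massMeasure L T))
    (hH : IsDensity T (massMeasure L T) H) {C : Set X} (hC : MeasurableSet C) :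
    massMeasure L (fun f π => ∫ x in C, f.1 x * H (lipCoord π) x ∂massMeasure L T)
      = (massMeasure L T).restrict C := by
  have := hμ.1
  refine le_antisymm (sInf_le ⟨inferInstance, hH.abs_setIntegral_le hμ C⟩) (le_sInf ?_)
  rintro ν ⟨hν, hνb⟩
  -- A bound `ν` for the part of `T` in `C`, completed by ‖T‖ off `C`, is a bound for all of `T`;
  -- minimality of ‖T‖ applies, and restricting to `C` removes the added part.
  have h1 : massMeasure L T ≤ ν + (massMeasure L T).restrict Cᶜ := by
    refine sInf_le ⟨inferInstance, fun f π => ?_⟩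
    rw [hH, ← integral_add_compl hC (lipB_integrable_mul f (L1.integrable_coeFn _)),
      integral_add_measure (lipB_integrable f _).abs (lipB_integrable f _).abs, mul_add]
    exact (abs_add_le _ _).trans (add_le_add (hνb f π) (hH.abs_setIntegral_le hμ Cᶜ f π))
  calc (massMeasure L T).restrict C ≤ (ν + (massMeasure L T).restrict Cᶜ).restrict C :=
        Measure.restrict_mono_measure h1 C
    _ = ν.restrict C := by
      rw [Measure.restrict_add, Measure.restrict_restrict hC, Set.inter_compl_self,
        Measure.restrict_empty, add_zero]
    _ ≤ ν := Measure.restrict_le_self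

/-- A measure which vanishes on `ℋⁿ`-null Borel sets and is concentrated on `S` is concentrated on
the images of a bi-Lipschitz parametrization of `S`. -/
theorem IsBiLipschitzParam.measure_compl_eq_zero {S : Set X} {K : ℕ → Set (E n)}
    {φ : ∀ i, K i → X} (hφ : IsBiLipschitzParam S K φ) (hS : ConcentratedOn μ S)
    (hvan : ∀ B : Set X, MeasurableSet B →
      (Measure.hausdorffMeasure (n : ℝ) : Measure X) B = 0 → μ B = 0) :
    μ (⋃ i, Set.range (φ i))ᶜ = 0 := by
  -- `S` need not be Borel, whereas the vanishing hypothesis concerns Borel sets: pass to a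
  -- measurable hull of the same ℋⁿ-measure.
  have h1 : μ (symmDiff S (⋃ i, Set.range (φ i))) = 0 :=
    measure_mono_null (subset_toMeasurable (Measure.hausdorffMeasure (n : ℝ)) _)
      (hvan _ (measurableSet_toMeasurable _ _) (by rw [measure_toMeasurable, hφ.ae_eq]))
  refine measure_mono_null (t := Sᶜ ∪ symmDiff S (⋃ i, Set.range (φ i))) (fun x hx => ?_)
    (measure_union_null hS h1)
  by_cases hxS : x ∈ S
  · exact .inr (.inl ⟨hxS, hx⟩)
  · exact .inl hxS

end Parametrization

end LCurrent

/-! ### The decomposition of a rectifiable current -/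

theorem proposition3p1 {X : Type*} [MetricSpace X] [CompleteSpace X] [MeasurableSpace X]
    [BorelSpace X] {n : ℕ} (hn : 1 ≤ n)
    (L : Seminorm ℝ (LCurrent.Lip X (LCurrent.E n))) (hL : LCurrent.IsCompatible L)
    (T : LCurrent.Functional X n) (hT : LCurrent.IsRectifiable L T)
    (S : Set X) (hS : LCurrent.IsRectifiableSet n S)
    (hTS : LCurrent.ConcentratedOn (LCurrent.massMeasure L T) S)
    (K : ℕ → Set (LCurrent.E n)) (φ : ∀ i, K i → X)
    (hφ : LCurrent.IsBiLipschitzParam S K φ) :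
    ∃ θ : ℕ → LCurrent.E n → ℝ,
      (∀ i, Integrable (θ i)) ∧
      (∀ i, tsupport (θ i) ⊆ K i) ∧
      (∀ i, LCurrent.IsLCurrent L
        (LCurrent.pushforward (φ i) (hφ.lipschitz i)
          (LCurrent.euclideanCurrentOn (θ i) (K i)))) ∧
      (∀ (f : LCurrent.LipB X) (π : LCurrent.Lip X (LCurrent.E n)),
        HasSum
          (fun i => LCurrent.pushforward (φ i) (hφ.lipschitz i)
            (LCurrent.euclideanCurrentOn (θ i) (K i)) f π)
          (T f π)) ∧
      LCurrent.massMeasure L T =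
        Measure.sum fun i => LCurrent.massMeasure L
          (LCurrent.pushforward (φ i) (hφ.lipschitz i)
            (LCurrent.euclideanCurrentOn (θ i) (K i))) := by
  obtain ⟨μ₀, hμ₀⟩ := hT.isLCurrent.finiteMass
  -- The density is taken with respect to ‖T‖ itself and not `μ₀`: only ‖T‖ is known to vanish on
  -- ℋⁿ-null sets and to be concentrated on `S`.
  have hμ := LCurrent.massBound_massMeasure hT.isLCurrent.multilinear hμ₀
  obtain ⟨H, hH⟩ := LCurrent.exists_isDensity hT.isLCurrent.multilinear hμ
  have hC : ∀ i, MeasurableSet (Set.range (φ i)) := fun i => by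
    have : CompactSpace (K i) := isCompact_iff_compactSpace.1 (hφ.compact i)
    obtain ⟨C, hC⟩ := hφ.lipschitz i
    exact (isCompact_range hC.continuous).measurableSet
  choose θ hθ hθK hθT using fun i => hH.exists_pushforward_eq hL hT.isLCurrent hμ hT.vanishes
    (hφ.compact i) (hφ.lipschitz i) (hφ.antilipschitz i)
  have hθT' : ∀ i, LCurrent.pushforward (φ i) (hφ.lipschitz i)
      (LCurrent.euclideanCurrentOn (θ i) (K i)) = fun f π =>
        ∫ x in Set.range (φ i), f.1 x * H (LCurrent.lipCoord π) x ∂LCurrent.massMeasure L T :=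
    fun i => funext fun f => funext fun π => hθT i f π
  have hdisj : Pairwise (Function.onFun Disjoint fun i => Set.range (φ i)) :=
    fun i j => hφ.disjoint i j
  have hrestrict : (LCurrent.massMeasure L T).restrict (⋃ i, Set.range (φ i))
      = LCurrent.massMeasure L T :=
    Measure.restrict_eq_self_of_ae_mem (hφ.measure_compl_eq_zero hTS hT.vanishes)
  refine ⟨θ, hθ, hθK, fun i => ?_, fun f π => ?_, ?_⟩
  · rw [hθT' i]
    exact hH.isLCurrent_setIntegral hL hT.isLCurrent hμ (hC i)
  · simp only [hθT]
    -- Summability here is unconditional, which for real series is absolute convergence.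
    have h := hasSum_integral_iUnion hC hdisj
      (LCurrent.lipB_integrable_mul f (L1.integrable_coeFn (H (LCurrent.lipCoord π)))).integrableOn
    rwa [hrestrict, ← hH f π] at h
  · simp only [hθT', LCurrent.massMeasure_setIntegral hμ hH (hC _)]
    rw [← Measure.restrict_iUnion hdisj hC, hrestrict]
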